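/- **Asymptotically conservative/valid prediction intervals with the Jackknife+.** *Setting.* For $p,n\in\mathbb N$ let $\mathcal A_{p,n}:\mathbb R^p\times(\mathbb R\times\mathbb R^p)^n\to\mathbb R$ be Borel measurable (the prediction algorithm). For every $n\ge 2$ let $p_n\in\mathbb N$, let $\mathcal P_n$ be a Borel probability measure on $\mathbb R\times\mathbb R^{p_n}$, and let $(y_i,x_i)=(y_i^{(n)},x_i^{(n)})$, $1\le i\le n+1$, be i.i.d. with law $\mathcal P_n$, defined on some probability space that may depend on $n$. Write $T_n=(y_i,x_i)_{i=1}^n$ for the training data, $T_n^{\backslash i}$ for $T_n$ without its $i$-th pair, $\hat y_{n+1}=\mathcal A_{p_n,n}(x_{n+1},T_n)$, $\hat y_j^{\backslash i}=\mathcal A_{p_n,n-1}(x_j,T_n^{\backslash i})$, $\hat u_i=y_i-\hat y_i^{\backslash i}$ and $v_i^+=\hat y_{n+1}^{\backslash i}+\hat u_i$ for $1\le i\le n$. Let $\widehat G_n^+(t)=\frac1n\sum_{i=1}^n \mathbf 1\{v_i^+\le t\}$ and, for $F:\mathbb R\to[0,1]$ and $\alpha\in\mathbb R$, $Q_\alpha(F)=\inf\{x\in\mathbb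 R:F(x)\ge\alpha\}\in[-\infty,\infty]$ (with $\inf\emptyset=+\infty$). For $\delta\in\mathbb R$ the $\delta$-distorted Jackknife+ interval is $$PI^{J+}_{\alpha_1,\alpha_2}(\delta)=[\,Q_{\alpha_1}(\widehat G_n^+)-\delta,\;Q_{\alpha_2}(\widehat G_n^+)+\delta\,],$$ where $[a,b]=\emptyset$ if $a>b$. Conditional probabilities given $T_n$ are computed from the regular conditional distribution of $(y_{n+1},x_{n+1})$ given $T_n$. *Assumption CC.* (a) For every $n\ge2$ and for almost every $x$ with respect to the law of $x_1^{(n)}$, the conditional distribution of $y_1^{(n)}$ given $x_1^{(n)}=x$ is absolutely continuous, and its density $f_{y_1^{(n)}\|x_1^{(n)}=x}$ has finite (essential) supremum norm; (b) the sequence of random variables $\|f_{y_1^{(n)}\|x_1^{(n)}}\|_\infty$, $n\ge2$, is stochastically bounded. *Statement.* Assume that the sequence of prediction errors $y_{n+1}-\hat y_{n+1}$, $n\ge2$, is stochastically bounded and that the predictor is stable, that is, $$\lim_{n\to\infty}\frac1n\sum_{i=1}^n\mathbb P\big(|\hat y_{n+1}-\hat y_{n+1}^{\backslash i}|\ge\epsilon\big)=0\quad\text{for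 all }\epsilon>0.$$ Then the following hold. (i) *General case.* For every $\delta>0$ and every $\epsilon>0$, $$\lim_{n\to\infty}\mathbb P\Big(\inf_{0\le\alpha_1\le\alpha_2\le1}\big[\mathbb P(y_{n+1}\in PI^{J+}_{\alpha_1,\alpha_2}(\delta)\,|\,T_n)-(\alpha_2-\alpha_1)\big]\ge-\epsilon\Big)=1$$ and $$\lim_{n\to\infty}\mathbb P\Big(\sup_{0\le\alpha_1\le\alpha_2\le1}\big[\mathbb P(y_{n+1}\in PI^{J+}_{\alpha_1,\alpha_2}(-\delta)\,|\,T_n)-(\alpha_2-\alpha_1)\big]\le\epsilon\Big)=1.$$ (ii) *Continuous case.* If, in addition, Assumption CC holds, then $$\lim_{n\to\infty}\mathbb E\Big(\sup_{0\le\alpha_1\le\alpha_2\le1}\big|\mathbb P(y_{n+1}\in PI^{J+}_{\alpha_1,\alpha_2}(0)\,|\,T_n)-(\alpha_2-\alpha_1)\big|\Big)=0.$$ -/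

import Mathlib

open MeasureTheory ProbabilityTheory Filter Topology
open scoped ENNReal NNReal

noncomputable section

namespace JackknifePlus

/-- A response-feature pair `(y, x)` with `y` real and `x` a vector with `p` coordinates. -/
abbrev Pair (p : ℕ) : Type := ℝ × (Fin p → ℝ)

/-- A family of prediction algorithms, one for each number `p` of features and each number `n`
of training pairs; its value at `x` and `T` predicts the response that belongs to the feature
vector `x` on the basis of the training data `T`. -/
abbrev Algorithm : Type := ∀ p n : ℕ, (Fin p → ℝ) → (Fin n → Pair p) → ℝ

/-- Each of the algorithms is a Borel function of the new features and the training data. -/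
def Algorithm.IsMeasurable (A : Algorithm) : Prop :=
  ∀ p n : ℕ, Measurable fun q : (Fin p → ℝ) × (Fin n → Pair p) => A p n q.1 q.2

/-- The training data without the `i`-th pair; the order of the other pairs is kept. -/
def leaveOut {p n : ℕ} (T : Fin n → Pair p) (i : Fin n) : Fin (n - 1) → Pair p :=
  fun j =>
    if j.val < i.val then T ⟨j.val, by have := j.isLt; omega⟩
    else T ⟨j.val + 1, by have := j.isLt; omega⟩

/-- The leave-one-out prediction at the features `x`, which does not use the `i`-th pair. -/
def looPredict (A : Algorithm) {p n : ℕ} (T : Fin n → Pair p) (i : Fin n) (x : Fin p → ℝ) : ℝ :=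
  A p (n - 1) x (leaveOut T i)

/-- The `i`-th leave-one-out residual. -/
def looResidual (A : Algorithm) {p n : ℕ} (T : Fin n → Pair p) (i : Fin n) : ℝ :=
  (T i).1 - looPredict A T i (T i).2

/-- The empirical distribution function of `v 0, …, v (n - 1)`. -/
def ecdf {n : ℕ} (v : Fin n → ℝ) (t : ℝ) : ℝ :=
  (1 / (n : ℝ)) * ∑ i : Fin n, Set.indicator (Set.Iic t) (fun _ => (1 : ℝ)) (v i)

/-- The `α`-quantile `inf {x : ℝ | F x ≥ α}` in the extended reals, for every real `α`. -/
def quantile (F : ℝ → ℝ) (α : ℝ) : EReal :=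
  sInf ((fun x : ℝ => (x : EReal)) '' {x : ℝ | α ≤ F x})

/-- The points whose empirical distribution gives the Jackknife+ interval at the features `x`:
leave-one-out prediction at `x` plus leave-one-out residual. -/
def plusPoint (A : Algorithm) {p n : ℕ} (T : Fin n → Pair p) (x : Fin p → ℝ) (i : Fin n) : ℝ :=
  looPredict A T i x + looResidual A T i

/-- The `δ`-distorted Jackknife+ prediction interval at the features `x` with nominal levels
`α₁` and `α₂`, as a set of real numbers. -/
def plusInterval (A : Algorithm) {p n : ℕ} (T : Fin n → Pair p) (δ α₁ α₂ : ℝ)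
    (x : Fin p → ℝ) : Set ℝ :=
  {y : ℝ | quantile (ecdf (plusPoint A T x)) α₁ - (δ : EReal) ≤ (y : EReal) ∧
    (y : EReal) ≤ quantile (ecdf (plusPoint A T x)) α₂ + (δ : EReal)}

section Sample

variable {Ω : Type*} [MeasurableSpace Ω] {p n : ℕ}

/-- `Z 0, …, Z n` are independent random pairs with law `P`. The first `n` of them are the
training data and the last one is the new pair. -/
structure IsIIDSample (μ : Measure Ω) (P : Measure (Pair p)) (Z : Fin (n + 1) → Ω → Pair p) :
    Prop where
  measurable : ∀ i, Measurable (Z i)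
  indep : iIndepFun Z μ
  law : ∀ i, μ.map (Z i) = P

/-- The training data `T_n`. -/
def training (Z : Fin (n + 1) → Ω → Pair p) (ω : Ω) : Fin n → Pair p :=
  fun i => Z i.castSucc ω

/-- The predictor of the new response from the new features and all training data. -/
def predictor (A : Algorithm) (Z : Fin (n + 1) → Ω → Pair p) (ω : Ω) : ℝ :=
  A p n (Z (Fin.last n) ω).2 (training Z ω)

/-- The prediction error for the new response. -/
def predictionError (A : Algorithm) (Z : Fin (n + 1) → Ω → Pair p) (ω : Ω) : ℝ :=
  (Z (Fin.last n) ω).1 - predictor A Z ω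

/-- The leave-one-out analogue of the predictor, without the `i`-th training pair. -/
def looPredictor (A : Algorithm) (Z : Fin (n + 1) → Ω → Pair p) (i : Fin n) (ω : Ω) : ℝ :=
  looPredict A (training Z ω) i (Z (Fin.last n) ω).2

/-- The conditional probability, given the training data, that the `δ`-distorted Jackknife+
interval contains the new response. The regular version is used: the conditional distribution of
the new pair `(y, x)` given the training data `T`, evaluated at the set of all `(y, x)` for which
`y` lies in the interval computed from `T` and `x`. -/
def condCoverage (μ : Measure Ω) [IsFiniteMeasure μ] (A : Algorithm)
    (Z : Fin (n + 1) → Ω → Pair p) (δ α₁ α₂ : ℝ) (ω : Ω) : ℝ :=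
  (condDistrib (Z (Fin.last n)) (training Z) μ (training Z ω)).real
    {z : Pair p | z.1 ∈ plusInterval A (training Z ω) δ α₁ α₂ z.2}

end Sample

/-- The pairs of nominal levels `0 ≤ α₁ ≤ α₂ ≤ 1`. -/
abbrev Levels : Type := {α : ℝ × ℝ // 0 ≤ α.1 ∧ α.1 ≤ α.2 ∧ α.2 ≤ 1}

/-- Stochastic boundedness (tightness) of a sequence, indexed by `n ≥ 2`, of random variables
with values in `[0, ∞]`, each on its own probability space. -/
def StochBounded {Ω : ℕ → Type*} [∀ n, MeasurableSpace (Ω n)] (μ : ∀ n, Measure (Ω n))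
    (X : ∀ n, Ω n → ℝ≥0∞) : Prop :=
  ∀ ε : ℝ≥0∞, 0 < ε → ∃ M : ℝ≥0, ∀ n : ℕ, 2 ≤ n → μ n {ω | (M : ℝ≥0∞) < X n ω} ≤ ε

/-- Asymptotic out-of-sample stability with respect to the leave-one-out analogues. -/
def Stable {Ω : ℕ → Type*} [∀ n, MeasurableSpace (Ω n)] (μ : ∀ n, Measure (Ω n)) {p : ℕ → ℕ}
    (A : Algorithm) (Z : ∀ n, Fin (n + 1) → Ω n → Pair (p n)) : Prop :=
  ∀ ε : ℝ, 0 < ε →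
    Tendsto (fun n : ℕ => (1 / (n : ℝ)) * ∑ i : Fin n,
      (μ n).real {ω | ε ≤ |predictor A (Z n) ω - looPredictor A (Z n) i ω|}) atTop (𝓝 0)

/-- The conditional distribution of the response `y` given the features `x`, when `(y, x)` has
law `P`. -/
def condResponse {p : ℕ} (P : Measure (Pair p)) [IsFiniteMeasure P] : Kernel (Fin p → ℝ) ℝ :=
  condDistrib Prod.fst Prod.snd P

/-- The supremum norm of the Lebesgue density of the response given the features `x`. Densities
are determined only up to null sets, so that this is an essential supremum. -/
def condDensitySup {p : ℕ} (P : Measure (Pair p)) [IsFiniteMeasure P] (x : Fin p → ℝ) : ℝ≥0∞ :=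
  essSup ((condResponse P x).rnDeriv volume) volume

/-- The Continuous Case Assumption: for almost every `x`, the response given the features `x` is
absolutely continuous with a bounded density, and the supremum norms of these densities, as random
variables in `x`, are stochastically bounded in `n`. -/
structure ContinuousCase {p : ℕ → ℕ} (P : ∀ n, Measure (Pair (p n)))
    [∀ n, IsProbabilityMeasure (P n)] : Prop where
  bounded_density : ∀ n : ℕ, 2 ≤ n → ∀ᵐ x ∂(P n).map Prod.snd,
    condResponse (P n) x ≪ volume ∧ condDensitySup (P n) x < ∞
  stochBounded : StochBounded (fun n => (P n).map Prod.snd) (fun n => condDensitySup (P n))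

end JackknifePlus

end

open JackknifePlus

/-!
The theorem rests on one fact about the training data `T`: with probability tending to one, the
empirical distribution of the leave-one-out residuals is close, in the Lévy distance, to the
distribution of the prediction error of a new pair given `T`, and for most new features most
leave-one-out predictions are close to the full prediction. Such `T` are called typical
(`IsTypical`).

*Typical data cover correctly.* A quantile bound for an empirical distribution function is a bound
for that function (`mem_plusInterval_iff`). For typical `T` and most new pairs the distribution
function of the Jackknife+ points at `y ± c` agrees, up to a further shift and a small error, with
that of the leave-one-out residuals at the prediction error `± c`
(`ecdf_plusPoint_le`, `le_ecdf_plusPoint`). The latter function is close to the distribution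
function of the prediction error, so its value there is nearly uniform, up to the shift; this gives
the coverage of the enlarged and the shrunk interval for all levels simultaneously
(`IsTypical.le_coverage`, `IsTypical.coverage_le`).

*Data are typical.* For a fixed ramp function, replacing an indicator, the average over the
leave-one-out residuals is compared with the conditional expectation at the prediction error. The
centred summands are uncorrelated up to an error controlled by the instability: the `i`-th summand
has conditional mean zero given the other points, and exchanging the `j`-th point for an
independent copy hardly changes it, because both leave-one-out predictors with the old and the new
`j`-th point are close to the predictor that does not see this point. This needs neither symmetry of
the algorithm nor stability for other sample sizes (`integral_abs_average_loss_sub_le`). As the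
prediction errors are tight, finitely many ramps on a grid suffice (`levy_of_grid`,
`tendsto_measureReal_not_isTypical`).

*Continuous case.* The enlarged and the shrunk interval differ by neighbourhoods of the two end
points. Since the conditional density of the response is bounded with high probability, these have
small probability (`coverage_le_coverage_neg_add`), and the undistorted interval lies in between.
The supremum over all levels is measurable since it may be restricted to rational levels
(`coverageError_eq_iSup_rat`).
-/

namespace JackknifePlus

/-! ### Resampling one sample point and a law of large numbers for leave-one-out losses -/

section Resampling

variable {ι E : Type*} [MeasurableSpace E]

lemma integral_comp_of_measurePreserving {α β : Type*} [MeasurableSpace α] [MeasurableSpace β]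
    {μ : Measure α} {ν : Measure β} {φ : α → β} (hφ : MeasurePreserving φ μ ν) {g : β → ℝ}
    (hg : Measurable g) : ∫ x, g (φ x) ∂μ = ∫ y, g y ∂ν := by
  rw [← hφ.map_eq, integral_map hφ.measurable.aemeasurable hg.aestronglyMeasurable]

lemma measurePreserving_prod_right_comm {α β γ : Type*} [MeasurableSpace α] [MeasurableSpace β]
    [MeasurableSpace γ] (μ : Measure α) (ν : Measure β) (ξ : Measure γ) [SFinite μ] [SFinite ν]
    [SFinite ξ] :
    MeasurePreserving (fun q : (α × β) × γ => ((q.1.1, q.2), q.1.2)) ((μ.prod ν).prod ξ)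
      ((μ.prod ξ).prod ν) := by
  have h1 := measurePreserving_prodAssoc μ ν ξ
  have h2 : MeasurePreserving (Prod.map (id : α → α) (Prod.swap : β × γ → γ × β))
      (μ.prod (ν.prod ξ)) (μ.prod (ξ.prod ν)) :=
    (MeasurePreserving.id μ).prod Measure.measurePreserving_swap
  have h3 := (measurePreserving_prodAssoc μ ξ ν).symm
  exact h3.comp (h2.comp h1)

lemma integrable_of_abs_le {Ω : Type*} [MeasurableSpace Ω] {μ : Measure Ω} [IsFiniteMeasure μ]
    {f : Ω → ℝ} (hf : Measurable f) {C : ℝ} (h : ∀ x, |f x| ≤ C) : Integrable f μ :=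
  Integrable.of_bound hf.aestronglyMeasurable C (ae_of_all _ h)

variable (P : Measure E) [IsProbabilityMeasure P]

/-- The loss `r` at the `i`-th sample point, centred by its mean at an independent point. -/
noncomputable def centredLoss (r : (ι → E) → E → ℝ) (i : ι) (T : ι → E) : ℝ :=
  r T (T i) - ∫ z, r T z ∂P

variable {P}

lemma measurable_integral_right {r : (ι → E) → E → ℝ} (hr : Measurable (Function.uncurry r)) :
    Measurable fun T => ∫ z, r T z ∂P :=
  (hr.stronglyMeasurable.integral_prod_right (ν := P)).measurable

lemma measurable_centredLoss {r : (ι → E) → E → ℝ} (hr : Measurable (Function.uncurry r))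
    (i : ι) : Measurable (centredLoss P r i) := by
  have h : Measurable fun T : ι → E => (T, T i) := by fun_prop
  exact (hr.comp h).sub (measurable_integral_right hr)

lemma integral_mem_Icc {Ω : Type*} [MeasurableSpace Ω] {μ : Measure Ω} [IsProbabilityMeasure μ]
    {f : Ω → ℝ} (hf : Measurable f) (h : ∀ x, f x ∈ Set.Icc (0 : ℝ) 1) :
    ∫ x, f x ∂μ ∈ Set.Icc (0 : ℝ) 1 := by
  refine ⟨integral_nonneg fun x => (h x).1, ?_⟩
  calc ∫ x, f x ∂μ ≤ ∫ _, (1 : ℝ) ∂μ :=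
        integral_mono (integrable_of_abs_le hf (C := 1) fun x => by
          rw [abs_of_nonneg (h x).1]; exact (h x).2) (integrable_const _) fun x => (h x).2
    _ = 1 := by simp

lemma abs_centredLoss_le {r : (ι → E) → E → ℝ} (hr : Measurable (Function.uncurry r))
    (h01 : ∀ T z, r T z ∈ Set.Icc (0 : ℝ) 1) (i : ι) (T : ι → E) :
    |centredLoss P r i T| ≤ 1 := by
  have h1 := h01 T (T i)
  have h2 : ∫ z, r T z ∂P ∈ Set.Icc (0 : ℝ) 1 :=
    integral_mem_Icc (hr.comp measurable_prodMk_left) (h01 T)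
  rw [centredLoss, abs_le]
  exact ⟨by linarith [h1.1, h2.2], by linarith [h1.2, h2.1]⟩

lemma abs_sub_le_one_of_mem_Icc {a b : ℝ} (ha : a ∈ Set.Icc (0 : ℝ) 1)
    (hb : b ∈ Set.Icc (0 : ℝ) 1) : |a - b| ≤ 1 :=
  abs_le.2 ⟨by linarith [ha.1, hb.2], by linarith [ha.2, hb.1]⟩

variable [DecidableEq ι]

lemma measurable_update_prod (i : ι) :
    Measurable (fun q : (ι → E) × E => Function.update q.1 i q.2) := by
  refine measurable_pi_lambda _ fun j => ?_
  by_cases h : j = i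
  · subst h; simpa using measurable_snd
  · simp only [Function.update_of_ne h]; fun_prop

variable [Fintype ι]

/-- Resampling one point of an independent sample does not change the law of the sample. -/
lemma measurePreserving_update (P : Measure E) [IsProbabilityMeasure P] (i : ι) :
    MeasurePreserving (fun q : (ι → E) × E => Function.update q.1 i q.2)
      ((Measure.pi fun _ : ι => P).prod P) (Measure.pi fun _ : ι => P) := by
  have hm := measurable_update_prod (E := E) i
  refine ⟨hm, (Measure.pi_eq fun s hs => ?_).symm⟩
  rw [Measure.map_apply hm (MeasurableSet.univ_pi hs)]
  have : (fun q : (ι → E) × E => Function.update q.1 i q.2) ⁻¹' Set.univ.pi s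
      = (Set.univ.pi (Function.update s i Set.univ)) ×ˢ s i := by
    ext q
    simp only [Set.mem_preimage, Set.mem_pi, Set.mem_univ, forall_true_left, Set.mem_prod]
    constructor
    · intro h
      refine ⟨fun j => ?_, by simpa using h i⟩
      by_cases hj : j = i
      · subst hj; simp
      · simpa [Function.update_of_ne hj] using h j
    · rintro ⟨h, h'⟩ j
      by_cases hj : j = i
      · subst hj; simpa using h'
      · simpa [Function.update_of_ne hj] using h j
  rw [this, Measure.prod_prod, Measure.pi_pi, ← Finset.mul_prod_erase _ _ (Finset.mem_univ i),
    ← Finset.mul_prod_erase _ (fun i => P (s i)) (Finset.mem_univ i)]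
  rw [Function.update_self, measure_univ, one_mul, mul_comm]
  congr 1
  refine Finset.prod_congr rfl fun j hj => ?_
  rw [Function.update_of_ne (Finset.ne_of_mem_erase hj)]

variable (P) in
/-- The mean distance, over an independent sample and an independent further point, of the
losses `r` and `r'`, functions of the sample and the further point. -/
noncomputable def meanDist (r r' : (ι → E) → E → ℝ) : ℝ :=
  ∫ q : (ι → E) × E, |r q.1 q.2 - r' q.1 q.2| ∂((Measure.pi fun _ : ι => P).prod P)

variable {r : (ι → E) → E → ℝ} {l : ι → (ι → E) → E → ℝ}

/-- Replacing the `j`-th sample point by an independent copy changes the leave-one-out loss `l i`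
little: pass from `l i` to `r`, on to `l j`, which does not see the `j`-th point, and back. -/
lemma integral_abs_sub_update_le (hr : Measurable (Function.uncurry r))
    (hl : ∀ i, Measurable (Function.uncurry (l i)))
    (r01 : ∀ T z, r T z ∈ Set.Icc (0 : ℝ) 1) (l01 : ∀ i T z, l i T z ∈ Set.Icc (0 : ℝ) 1)
    (hupd : ∀ i T z' z, l i (Function.update T i z') z = l i T z) (i j : ι) :
    ∫ q : ((ι → E) × E) × E, |l i q.1.1 q.2 - l i (Function.update q.1.1 j q.1.2) q.2|
        ∂(((Measure.pi fun _ : ι => P).prod P).prod P)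
      ≤ 2 * (meanDist P r (l i) + meanDist P r (l j)) := by
  set N := (Measure.pi fun _ : ι => P).prod P
  let g : ι → (ι → E) × E → ℝ := fun k q => |r q.1 q.2 - l k q.1 q.2|
  have hg : ∀ k, Measurable (g k) := fun k => (hr.sub (hl k)).abs
  have hg1 : ∀ k q, |g k q| ≤ 1 := fun k q => by
    simp only [g, abs_abs]; exact abs_sub_le_one_of_mem_Icc (r01 _ _) (l01 _ _ _)
  have hφ : MeasurePreserving (Prod.map Prod.fst id : ((ι → E) × E) × E → (ι → E) × E)
      (N.prod P) N := measurePreserving_fst.prod (MeasurePreserving.id P)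
  have hψ : MeasurePreserving
      (Prod.map (fun q : (ι → E) × E => Function.update q.1 j q.2) id :
        ((ι → E) × E) × E → (ι → E) × E) (N.prod P) N :=
    (measurePreserving_update P j).prod (MeasurePreserving.id P)
  have e : ∀ (k : ι) {f : ((ι → E) × E) × E → (ι → E) × E}, MeasurePreserving f (N.prod P) N →
      Integrable (fun q => g k (f q)) (N.prod P) ∧
        ∫ q, g k (f q) ∂(N.prod P) = meanDist P r (l k) := by
    intro k f hf
    refine ⟨integrable_of_abs_le ((hg k).comp hf.measurable) fun q => hg1 k _, ?_⟩
    exact integral_comp_of_measurePreserving hf (hg k)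
  obtain ⟨i1, e1⟩ := e i hφ
  obtain ⟨i2, e2⟩ := e j hφ
  obtain ⟨i3, e3⟩ := e j hψ
  obtain ⟨i4, e4⟩ := e i hψ
  have i12 : Integrable (fun q => g i (Prod.map Prod.fst id q) + g j (Prod.map Prod.fst id q))
    (N.prod P) := i1.add i2
  have i123 : Integrable (fun q => g i (Prod.map Prod.fst id q) + g j (Prod.map Prod.fst id q)
    + g j (Prod.map (fun q : (ι → E) × E => Function.update q.1 j q.2) id q)) (N.prod P) :=
    i12.add i3
  have hm : Measurable fun q : ((ι → E) × E) × E =>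
      |l i q.1.1 q.2 - l i (Function.update q.1.1 j q.1.2) q.2| :=
    (((hl i).comp hφ.measurable).sub ((hl i).comp hψ.measurable)).abs
  calc _ ≤ ∫ q, (g i (Prod.map Prod.fst id q) + g j (Prod.map Prod.fst id q)
          + g j (Prod.map (fun q : (ι → E) × E => Function.update q.1 j q.2) id q)
          + g i (Prod.map (fun q : (ι → E) × E => Function.update q.1 j q.2) id q))
            ∂(N.prod P) := by
        refine integral_mono (integrable_of_abs_le hm (C := 1) fun q => ?_)
          (i123.add i4) fun q => ?_
        · rw [abs_abs]; exact abs_sub_le_one_of_mem_Icc (l01 _ _ _) (l01 _ _ _)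
        · simp only [g, Prod.map_fst, Prod.map_snd, id, hupd j]
          set a := l i q.1.1 q.2
          set b := r q.1.1 q.2
          set c := l j q.1.1 q.2
          set d := r (Function.update q.1.1 j q.1.2) q.2
          set e := l i (Function.update q.1.1 j q.1.2) q.2
          have h1 := abs_sub_le a b e
          have h2 := abs_sub_le b c e
          have h3 := abs_sub_le c d e
          rw [abs_sub_comm a b] at h1
          rw [abs_sub_comm c d] at h3
          linarith
    _ = 2 * (meanDist P r (l i) + meanDist P r (l j)) := by
        rw [integral_add i123 i4, integral_add i12 i3,
          integral_add i1 i2, e1, e2, e3, e4]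
        ring

lemma measurePreserving_update_swap (P : Measure E) [IsProbabilityMeasure P] (i : ι) :
    MeasurePreserving (fun q : ((ι → E) × E) × E => (Function.update q.1.1 i q.2, q.1.2))
      (((Measure.pi fun _ : ι => P).prod P).prod P) ((Measure.pi fun _ : ι => P).prod P) :=
  ((measurePreserving_update P i).prod (MeasurePreserving.id P)).comp
    (measurePreserving_prod_right_comm _ P P)

/-- The centred leave-one-out loss changes little when another sample point is resampled. -/
lemma integral_abs_centredLoss_sub_update_le (hr : Measurable (Function.uncurry r))
    (hl : ∀ i, Measurable (Function.uncurry (l i)))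
    (r01 : ∀ T z, r T z ∈ Set.Icc (0 : ℝ) 1) (l01 : ∀ i T z, l i T z ∈ Set.Icc (0 : ℝ) 1)
    (hupd : ∀ i T z' z, l i (Function.update T i z') z = l i T z) {i j : ι} (hij : i ≠ j) :
    ∫ q : (ι → E) × E,
        |centredLoss P (l i) i q.1 - centredLoss P (l i) i (Function.update q.1 j q.2)|
        ∂((Measure.pi fun _ : ι => P).prod P)
      ≤ 4 * (meanDist P r (l i) + meanDist P r (l j)) := by
  have key := integral_abs_sub_update_le (P := P) hr hl r01 l01 hupd i j
  set N := (Measure.pi fun _ : ι => P).prod P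
  have hu := measurable_update_prod (E := E) j
  let f : (ι → E) × E → ℝ := fun q => |l i q.1 (q.1 i) - l i (Function.update q.1 j q.2) (q.1 i)|
  let h : ((ι → E) × E) × E → ℝ :=
    fun q => |l i q.1.1 q.2 - l i (Function.update q.1.1 j q.1.2) q.2|
  have hf : Measurable f := by
    have m1 : Measurable fun q : (ι → E) × E => (q.1, q.1 i) := by fun_prop
    have m2 : Measurable fun q : (ι → E) × E => (Function.update q.1 j q.2, q.1 i) :=
      hu.prodMk (by fun_prop)
    exact (((hl i).comp m1).sub ((hl i).comp m2)).abs
  have hh : Measurable h := by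
    have m1 : Measurable fun q : ((ι → E) × E) × E => (q.1.1, q.2) := by fun_prop
    have m2 : Measurable fun q : ((ι → E) × E) × E => (Function.update q.1.1 j q.1.2, q.2) :=
      (hu.comp measurable_fst).prodMk (by fun_prop)
    exact (((hl i).comp m1).sub ((hl i).comp m2)).abs
  have f1 : ∀ q, |f q| ≤ 1 := fun q => by
    simp only [f, abs_abs]; exact abs_sub_le_one_of_mem_Icc (l01 _ _ _) (l01 _ _ _)
  have h1 : ∀ q, |h q| ≤ 1 := fun q => by
    simp only [h, abs_abs]; exact abs_sub_le_one_of_mem_Icc (l01 _ _ _) (l01 _ _ _)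
  have ih : Integrable h (N.prod P) := integrable_of_abs_le hh h1
  have e1 : ∫ q, f q ∂N = ∫ q, h q ∂(N.prod P) := by
    have hp := measurePreserving_update_swap P i
    rw [← integral_comp_of_measurePreserving hp hf]
    refine integral_congr_ae (ae_of_all _ fun q => ?_)
    simp only [f, h, Function.update_self]
    rw [Function.update_comm hij, hupd, hupd]
  have e2 : ∫ q, h q ∂(N.prod P) = ∫ q, ∫ z, h (q, z) ∂P ∂N := integral_prod _ ih
  have i2 : Integrable (fun q => ∫ z, h (q, z) ∂P) N := ih.integral_prod_left
  have i1 : Integrable f N := integrable_of_abs_le hf f1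
  have hc := measurable_centredLoss (P := P) (hl i) i
  calc _ ≤ ∫ q, (f q + ∫ z, h (q, z) ∂P) ∂N := by
        refine integral_mono (integrable_of_abs_le (C := 2)
          ((hc.comp measurable_fst).sub (hc.comp hu)).abs fun q => ?_) (i1.add i2) fun q => ?_
        · rw [abs_abs]
          refine (abs_sub _ _).trans ?_
          linarith [abs_centredLoss_le (P := P) (hl i) (l01 i) i q.1,
            abs_centredLoss_le (P := P) (hl i) (l01 i) i (Function.update q.1 j q.2)]
        · have il : ∀ T, Integrable (fun z => l i T z) P := fun T =>
            integrable_of_abs_le ((hl i).comp measurable_prodMk_left) (C := 1) fun z => by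
              rw [abs_of_nonneg (l01 _ _ _).1]
              exact (l01 _ _ _).2
          have : |∫ z, l i q.1 z ∂P - ∫ z, l i (Function.update q.1 j q.2) z ∂P|
              ≤ ∫ z, h (q, z) ∂P := by
            rw [← integral_sub (il _) (il _)]
            exact abs_integral_le_integral_abs
          simp only [centredLoss, Function.update_of_ne hij, f]
          set a := l i q.1 (q.1 i)
          set b := l i (Function.update q.1 j q.2) (q.1 i)
          set c := ∫ z, l i q.1 z ∂P
          set d := ∫ z, l i (Function.update q.1 j q.2) z ∂P
          calc |a - c - (b - d)| = |(a - b) - (c - d)| := by ring_nf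
            _ ≤ |a - b| + |c - d| := abs_sub _ _
            _ ≤ _ := by linarith
    _ = 2 * ∫ q, h q ∂(N.prod P) := by rw [integral_add i1 i2, e1, ← e2]; ring
    _ ≤ _ := by linarith

/-- If `T j` is resampled in the first factor only, then the second factor, which has conditional
mean zero given the other points, makes the integral vanish. -/
lemma integral_centredLoss_update_mul (hl : ∀ i, Measurable (Function.uncurry (l i)))
    (l01 : ∀ i T z, l i T z ∈ Set.Icc (0 : ℝ) 1)
    (hupd : ∀ i T z' z, l i (Function.update T i z') z = l i T z) (i j : ι) :
    ∫ q : (ι → E) × E,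
        centredLoss P (l i) i (Function.update q.1 j q.2) * centredLoss P (l j) j q.1
        ∂((Measure.pi fun _ : ι => P).prod P) = 0 := by
  have hu := measurable_update_prod (E := E) j
  have hci := measurable_centredLoss (P := P) (hl i) i
  have hcj := measurable_centredLoss (P := P) (hl j) j
  have hp := measurePreserving_update_swap P j
  have hm : Measurable fun q : (ι → E) × E =>
      centredLoss P (l i) i (Function.update q.1 j q.2) * centredLoss P (l j) j q.1 :=
    (hci.comp hu).mul (hcj.comp measurable_fst)
  have hb : ∀ q : (ι → E) × E,
      |centredLoss P (l i) i (Function.update q.1 j q.2) * centredLoss P (l j) j q.1| ≤ 1 :=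
    fun q => by
      rw [abs_mul]
      exact mul_le_one₀ (abs_centredLoss_le (hl i) (l01 i) _ _) (abs_nonneg _)
        (abs_centredLoss_le (hl j) (l01 j) _ _)
  rw [← integral_comp_of_measurePreserving hp hm]
  refine (integral_prod _ (integrable_of_abs_le (C := 1) (hm.comp hp.measurable)
    fun q => hb _)).trans ?_
  refine integral_eq_zero_of_ae (ae_of_all _ fun q => ?_)
  simp only [Function.comp_apply, Function.update_idem, Pi.zero_apply]
  rw [integral_const_mul]
  have il : Integrable (fun z => l j q.1 z) P :=
    integrable_of_abs_le ((hl j).comp measurable_prodMk_left) (C := 1) fun z => by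
      rw [abs_of_nonneg (l01 _ _ _).1]
      exact (l01 _ _ _).2
  simp only [centredLoss, hupd j, Function.update_self]
  rw [integral_sub il (integrable_const _)]
  simp

/-- The centred leave-one-out losses are nearly uncorrelated. -/
lemma integral_centredLoss_mul_le (hr : Measurable (Function.uncurry r))
    (hl : ∀ i, Measurable (Function.uncurry (l i)))
    (r01 : ∀ T z, r T z ∈ Set.Icc (0 : ℝ) 1) (l01 : ∀ i T z, l i T z ∈ Set.Icc (0 : ℝ) 1)
    (hupd : ∀ i T z' z, l i (Function.update T i z') z = l i T z) {i j : ι} (hij : i ≠ j) :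
    ∫ T : ι → E, centredLoss P (l i) i T * centredLoss P (l j) j T ∂(Measure.pi fun _ : ι => P)
      ≤ 4 * (meanDist P r (l i) + meanDist P r (l j)) := by
  refine le_trans ?_ (integral_abs_centredLoss_sub_update_le (P := P) hr hl r01 l01 hupd hij)
  have hu := measurable_update_prod (E := E) j
  have hci := measurable_centredLoss (P := P) (hl i) i
  have hcj := measurable_centredLoss (P := P) (hl j) j
  have bi := abs_centredLoss_le (P := P) (hl i) (l01 i) i
  have bj := abs_centredLoss_le (P := P) (hl j) (l01 j) j
  have hfst : MeasurePreserving (Prod.fst : (ι → E) × E → ι → E)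
      ((Measure.pi fun _ : ι => P).prod P) (Measure.pi fun _ : ι => P) := measurePreserving_fst
  have h0 := integral_centredLoss_update_mul (P := P) hl l01 hupd i j
  have hb : ∀ S T, |centredLoss P (l i) i S * centredLoss P (l j) j T| ≤ 1 := fun S T => by
    rw [abs_mul]; exact mul_le_one₀ (bi _) (abs_nonneg _) (bj _)
  have hm : Measurable fun T => centredLoss P (l i) i T * centredLoss P (l j) j T := hci.mul hcj
  have hm' : Measurable fun q : (ι → E) × E =>
      centredLoss P (l i) i (Function.update q.1 j q.2) * centredLoss P (l j) j q.1 :=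
    (hci.comp hu).mul (hcj.comp measurable_fst)
  have i1 : Integrable (fun q : (ι → E) × E =>
      centredLoss P (l i) i q.1 * centredLoss P (l j) j q.1)
      ((Measure.pi fun _ : ι => P).prod P) :=
    integrable_of_abs_le (C := 1) (hm.comp measurable_fst) fun q => hb _ _
  have i2 := integrable_of_abs_le (μ := (Measure.pi fun _ : ι => P).prod P) (C := 1) hm'
    fun q => hb _ _
  rw [← integral_comp_of_measurePreserving hfst hm, ← sub_zero (integral _ _), ← h0,
    ← integral_sub i1 i2]
  refine integral_mono (i1.sub i2) (integrable_of_abs_le (C := 2)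
        ((hci.comp measurable_fst).sub (hci.comp hu)).abs fun q => ?_) fun q => ?_
  · rw [abs_abs]
    refine (abs_sub _ _).trans ?_
    exact (add_le_add (bi _) (bi _)).trans (by norm_num)
  · simp only
    rw [← sub_mul]
    refine (le_abs_self _).trans ?_
    rw [abs_mul]
    exact mul_le_of_le_one_right (abs_nonneg _) (bj _)

lemma integral_sq_sum_centredLoss_le (hr : Measurable (Function.uncurry r))
    (hl : ∀ i, Measurable (Function.uncurry (l i)))
    (r01 : ∀ T z, r T z ∈ Set.Icc (0 : ℝ) 1) (l01 : ∀ i T z, l i T z ∈ Set.Icc (0 : ℝ) 1)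
    (hupd : ∀ i T z' z, l i (Function.update T i z') z = l i T z) :
    ∫ T : ι → E, (∑ i, centredLoss P (l i) i T) ^ 2 ∂(Measure.pi fun _ : ι => P)
      ≤ Fintype.card ι + 8 * Fintype.card ι * ∑ i, meanDist P r (l i) := by
  have hc := fun i => measurable_centredLoss (P := P) (hl i) i
  have b := fun i => abs_centredLoss_le (P := P) (hl i) (l01 i) i
  have hb : ∀ i j T, |centredLoss P (l i) i T * centredLoss P (l j) j T| ≤ 1 := fun i j T => by
    rw [abs_mul]; exact mul_le_one₀ (b i _) (abs_nonneg _) (b j _)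
  have hi : ∀ i j, Integrable (fun T => centredLoss P (l i) i T * centredLoss P (l j) j T)
      (Measure.pi fun _ : ι => P) := fun i j =>
    integrable_of_abs_le (C := 1) ((hc i).mul (hc j)) (hb i j)
  have s0 : ∀ i, 0 ≤ meanDist P r (l i) := fun i => integral_nonneg fun _ => abs_nonneg _
  simp_rw [sq, Finset.sum_mul_sum]
  rw [integral_finsetSum _ fun i _ => integrable_finsetSum _ fun j _ => hi i j]
  simp_rw [integral_finsetSum _ fun j (_ : j ∈ Finset.univ) => hi _ j]
  calc _ ≤ ∑ i, ∑ j, ((if i = j then (1 : ℝ) else 0)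
          + 4 * (meanDist P r (l i) + meanDist P r (l j))) := by
        refine Finset.sum_le_sum fun i _ => Finset.sum_le_sum fun j _ => ?_
        split_ifs with h
        -- on the diagonal the trivial bound `1` suffices
        · have : ∫ T : ι → E, centredLoss P (l i) i T * centredLoss P (l j) j T
              ∂(Measure.pi fun _ : ι => P) ≤ ∫ _, (1 : ℝ) ∂(Measure.pi fun _ : ι => P) :=
            integral_mono (hi i j) (integrable_const _) fun T => (le_abs_self _).trans (hb i j T)
          simp only [integral_const, probReal_univ, smul_eq_mul, mul_one] at this
          linarith [s0 i, s0 j]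
        · rw [zero_add]
          exact integral_centredLoss_mul_le hr hl r01 l01 hupd h
    _ = _ := by
        simp only [Finset.sum_add_distrib, Finset.sum_ite_eq, Finset.mem_univ, if_true,
          ← Finset.mul_sum, Finset.sum_const, Finset.card_univ, nsmul_eq_mul, mul_one]
        ring

/-- **Law of large numbers for leave-one-out losses.** If the losses `l i`, which do not see the
`i`-th sample point, are on average close to the loss `r`, then the average leave-one-out loss
is close in mean to the expected loss of an independent point given the sample. -/
theorem integral_abs_average_loss_sub_le [Nonempty ι] (hr : Measurable (Function.uncurry r))
    (hl : ∀ i, Measurable (Function.uncurry (l i)))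
    (r01 : ∀ T z, r T z ∈ Set.Icc (0 : ℝ) 1) (l01 : ∀ i T z, l i T z ∈ Set.Icc (0 : ℝ) 1)
    (hupd : ∀ i T z' z, l i (Function.update T i z') z = l i T z) {s c : ℝ} (hc : 0 < c)
    (hs : (1 / (Fintype.card ι : ℝ)) * ∑ i, meanDist P r (l i) ≤ s) :
    ∫ T : ι → E, |(1 / (Fintype.card ι : ℝ)) * ∑ i, l i T (T i) - ∫ z, r T z ∂P|
        ∂(Measure.pi fun _ : ι => P)
      ≤ s + c + (1 / (Fintype.card ι : ℝ) + 8 * s) / c := by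
  set n : ℝ := (Fintype.card ι : ℝ) with hn
  have hn0 : 0 < n := by rw [hn]; exact_mod_cast Fintype.card_pos
  set N := Measure.pi fun _ : ι => P
  have hsq := integral_sq_sum_centredLoss_le (P := P) hr hl r01 l01 hupd
  rw [← hn] at hsq
  have hcm := fun i => measurable_centredLoss (P := P) (hl i) i
  have b := fun i => abs_centredLoss_le (P := P) (hl i) (l01 i) i
  let X : (ι → E) → ℝ := fun T => ∑ i, centredLoss P (l i) i T
  have hX : Measurable X := Finset.measurable_sum _ fun i _ => hcm i
  have bX : ∀ T, |X T| ≤ n := fun T => by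
    refine (Finset.abs_sum_le_sum_abs _ _).trans ?_
    refine (Finset.sum_le_sum fun i _ => b i T).trans ?_
    simp [hn]
  have iX2 : Integrable (fun T => X T ^ 2) N :=
    integrable_of_abs_le (C := n ^ 2) (hX.pow_const 2) fun T => by
      rw [abs_pow]; exact pow_le_pow_left₀ (abs_nonneg _) (bX T) 2
  let g : ι → (ι → E) × E → ℝ := fun k q => |r q.1 q.2 - l k q.1 q.2|
  have hg : ∀ k, Measurable (g k) := fun k => (hr.sub (hl k)).abs
  have ig : ∀ k, Integrable (g k) (N.prod P) := fun k =>
    integrable_of_abs_le (hg k) (C := 1) fun q => by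
      simp only [g, abs_abs]; exact abs_sub_le_one_of_mem_Icc (r01 _ _) (l01 _ _ _)
  have ig' : ∀ k, Integrable (fun T => ∫ z, g k (T, z) ∂P) N := fun k => (ig k).integral_prod_left
  have eg : ∀ k, ∫ T, ∫ z, g k (T, z) ∂P ∂N = meanDist P r (l k) := fun k =>
    (integral_prod _ (ig k)).symm
  have iint : ∀ {f : (ι → E) → E → ℝ}, Measurable (Function.uncurry f) →
      (∀ T z, f T z ∈ Set.Icc (0 : ℝ) 1) → ∀ T, Integrable (fun z => f T z) P :=
    fun hf hf1 T => integrable_of_abs_le (hf.comp measurable_prodMk_left) (C := 1) fun z => by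
      rw [abs_of_nonneg (hf1 _ _).1]
      exact (hf1 _ _).2
  have iG : Integrable (fun T => (1 / n) * ∑ k, ∫ z, g k (T, z) ∂P) N :=
    (integrable_finsetSum _ fun k _ => ig' k).const_mul _
  have iX : Integrable (fun T => (1 / c) * ((1 / n) ^ 2 * X T ^ 2)) N :=
    (iX2.const_mul _).const_mul _
  have icX : Integrable (fun T => c + (1 / c) * ((1 / n) ^ 2 * X T ^ 2)) N :=
    (integrable_const c).add iX
  calc _ ≤ ∫ T, ((1 / n) * ∑ k, ∫ z, g k (T, z) ∂P
          + (c + (1 / c) * ((1 / n) ^ 2 * X T ^ 2))) ∂N := by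
        have hm : Measurable fun T : ι → E => |(1 / n) * ∑ i, l i T (T i) - ∫ z, r T z ∂P| := by
          refine Measurable.abs (Measurable.sub (Measurable.const_mul
            (Finset.measurable_sum _ fun i _ => ?_) _) (measurable_integral_right hr))
          have : Measurable fun T : ι → E => (T, T i) := by fun_prop
          exact (hl i).comp this
        refine integral_mono_of_nonneg (ae_of_all _ fun T => abs_nonneg _)
          (iG.add icX) (ae_of_all _ fun T => ?_)
        -- split into the centred losses and the distances of the conditional means
        have h1 : (1 / n) * ∑ i, l i T (T i) - ∫ z, r T z ∂P
            = (1 / n) * ∑ i, (∫ z, l i T z ∂P - ∫ z, r T z ∂P) + (1 / n) * X T := by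
          simp only [X, centredLoss, Finset.sum_sub_distrib, Finset.sum_const, Finset.card_univ,
            nsmul_eq_mul, ← hn]
          field_simp
          ring
        have h2 : |(1 / n) * ∑ i, (∫ z, l i T z ∂P - ∫ z, r T z ∂P)|
            ≤ (1 / n) * ∑ k, ∫ z, g k (T, z) ∂P := by
          rw [abs_mul, abs_of_pos (by positivity : 0 < 1 / n)]
          refine mul_le_mul_of_nonneg_left ?_ (by positivity)
          refine (Finset.abs_sum_le_sum_abs _ _).trans (Finset.sum_le_sum fun k _ => ?_)
          rw [abs_sub_comm, ← integral_sub (iint hr r01 T) (iint (hl k) (l01 k) T)]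
          exact abs_integral_le_integral_abs
        have h3 : |(1 / n) * X T| ≤ c + (1 / c) * ((1 / n) ^ 2 * X T ^ 2) := by
          set x := (1 / n) * X T with hx
          have : (1 / n) ^ 2 * X T ^ 2 = |x| ^ 2 := by rw [sq_abs, hx]; ring
          rw [this]
          have : (1 / c) * |x| ^ 2 - |x| + c = (1 / c) * ((|x| - c / 2) ^ 2 + 3 / 4 * c ^ 2) := by
            field_simp; ring
          have : 0 ≤ (1 / c) * ((|x| - c / 2) ^ 2 + 3 / 4 * c ^ 2) := by positivity
          linarith
        simp only
        rw [h1]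
        exact (abs_add_le _ _).trans (add_le_add h2 h3)
    _ = (1 / n) * ∑ i, meanDist P r (l i) + (c + (1 / c) * ((1 / n) ^ 2 * ∫ T, X T ^ 2 ∂N)) := by
        rw [integral_add iG icX, integral_add (integrable_const c) iX,
          integral_const_mul, integral_const_mul, integral_const_mul,
          integral_finsetSum _ fun k _ => ig' k]
        simp [eg]
    _ ≤ s + (c + (1 / c) * (1 / n + 8 * s)) := by
        gcongr
        calc (1 / n) ^ 2 * ∫ T, X T ^ 2 ∂N
            ≤ (1 / n) ^ 2 * (n + 8 * n * ∑ i, meanDist P r (l i)) := by gcongr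
          _ = 1 / n + 8 * ((1 / n) * ∑ i, meanDist P r (l i)) := by field_simp
          _ ≤ _ := by gcongr
    _ = _ := by ring

end Resampling

/-! ### Quantiles of empirical distribution functions -/

section Quantile

variable {n : ℕ}

/-- The left limit of the empirical distribution function: the proportion of points below `t`. -/
noncomputable def ecdfLeft (v : Fin n → ℝ) (t : ℝ) : ℝ :=
  (1 / (n : ℝ)) * ∑ i : Fin n, Set.indicator (Set.Iio t) (fun _ => (1 : ℝ)) (v i)

lemma average_mem_Icc {f : Fin n → ℝ} (hf : ∀ i, f i ∈ Set.Icc (0 : ℝ) 1) :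
    (1 / (n : ℝ)) * ∑ i, f i ∈ Set.Icc (0 : ℝ) 1 := by
  have h0 : 0 ≤ ∑ i, f i := Finset.sum_nonneg fun i _ => (hf i).1
  have h1 : ∑ i, f i ≤ n := by
    refine (Finset.sum_le_sum fun i _ => (hf i).2).trans ?_
    simp
  refine ⟨by positivity, ?_⟩
  rw [one_div, inv_mul_eq_div]
  exact div_le_one_of_le₀ h1 (by positivity)

lemma average_mono {f g : Fin n → ℝ} (h : ∀ i, f i ≤ g i) :
    (1 / (n : ℝ)) * ∑ i, f i ≤ (1 / (n : ℝ)) * ∑ i, g i :=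
  mul_le_mul_of_nonneg_left (Finset.sum_le_sum fun i _ => h i) (by positivity)

lemma indicator_one_mem_Icc {β : Type*} (s : Set β) (x : β) :
    s.indicator (fun _ => (1 : ℝ)) x ∈ Set.Icc (0 : ℝ) 1 := by
  by_cases h : x ∈ s <;> simp [h]

lemma indicator_one_le_indicator_one {β γ : Type*} {s : Set β} {t : Set γ} {x : β} {y : γ}
    (h : x ∈ s → y ∈ t) :
    s.indicator (fun _ => (1 : ℝ)) x ≤ t.indicator (fun _ => (1 : ℝ)) y := by
  by_cases hx : x ∈ s
  · simp [hx, h hx]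
  · rw [Set.indicator_of_notMem hx]; exact (indicator_one_mem_Icc t y).1

lemma ecdf_mem_Icc (v : Fin n → ℝ) (t : ℝ) : ecdf v t ∈ Set.Icc (0 : ℝ) 1 :=
  average_mem_Icc fun _ => indicator_one_mem_Icc _ _

lemma ecdf_mono (v : Fin n → ℝ) : Monotone (ecdf v) := fun _ _ h =>
  average_mono fun _ => indicator_one_le_indicator_one fun hx => le_trans hx h

lemma ecdfLeft_le_ecdf (v : Fin n → ℝ) (t : ℝ) : ecdfLeft v t ≤ ecdf v t :=
  average_mono fun _ => indicator_one_le_indicator_one fun hx => Set.Iio_subset_Iic_self hx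

lemma ecdf_le_ecdfLeft (v : Fin n → ℝ) {s t : ℝ} (h : s < t) : ecdf v s ≤ ecdfLeft v t :=
  average_mono fun _ => indicator_one_le_indicator_one fun hx => lt_of_le_of_lt hx h

lemma exists_ecdf_nonpos (v : Fin n → ℝ) : ∃ a, ecdf v a ≤ 0 := by
  obtain ⟨a, ha⟩ := (Set.finite_range v).bddBelow
  refine ⟨a - 1, ?_⟩
  rw [ecdf, Finset.sum_eq_zero, mul_zero]
  intro i _
  have := ha ⟨i, rfl⟩
  exact Set.indicator_of_notMem (fun h => by simp only [Set.mem_Iic] at h; linarith) _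

lemma exists_one_le_ecdf (hn : 0 < n) (v : Fin n → ℝ) : ∃ b, 1 ≤ ecdf v b := by
  obtain ⟨b, hb⟩ := (Set.finite_range v).bddAbove
  refine ⟨b, ?_⟩
  have h : ∀ i ∈ Finset.univ, Set.indicator (Set.Iic b) (fun _ => (1 : ℝ)) (v i) = 1 :=
    fun i _ => Set.indicator_of_mem (Set.mem_Iic.2 (hb ⟨i, rfl⟩)) _
  have : (n : ℝ) ≠ 0 := by positivity
  rw [ecdf, Finset.sum_congr rfl h]
  simp [this]

/-- An empirical distribution function is a step function, continuous from the right. -/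
lemma eventually_ecdf_eq (v : Fin n → ℝ) (y : ℝ) : ∀ᶠ t in 𝓝[>] y, ecdf v t = ecdf v y := by
  have : ∀ᶠ t in 𝓝[>] y, ∀ i, (v i ∈ Set.Iic t ↔ v i ∈ Set.Iic y) := by
    refine eventually_all.2 fun i => ?_
    by_cases h : v i ≤ y
    · filter_upwards [self_mem_nhdsWithin] with t ht
      exact iff_of_true (h.trans (le_of_lt ht)) h
    · filter_upwards [nhdsWithin_le_nhds (Iio_mem_nhds (not_le.1 h))] with t ht
      exact iff_of_false (fun h' => not_le.2 ht (Set.mem_Iic.1 h')) h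
  filter_upwards [this] with t ht
  simp only [ecdf, Set.indicator, ht]

lemma eventually_ecdf_eq_ecdfLeft (v : Fin n → ℝ) (y : ℝ) :
    ∀ᶠ t in 𝓝[<] y, ecdf v t = ecdfLeft v y := by
  have : ∀ᶠ t in 𝓝[<] y, ∀ i, (v i ∈ Set.Iic t ↔ v i ∈ Set.Iio y) := by
    refine eventually_all.2 fun i => ?_
    by_cases h : v i < y
    · filter_upwards [nhdsWithin_le_nhds (Ioi_mem_nhds h)] with t ht
      exact iff_of_true (Set.mem_Iic.2 (le_of_lt ht)) h
    · filter_upwards [self_mem_nhdsWithin] with t ht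
      exact iff_of_false (not_le.2 (lt_of_lt_of_le ht (not_lt.1 h))) h
  filter_upwards [this] with t ht
  simp only [ecdf, ecdfLeft, Set.indicator, ht]

lemma quantile_ecdf_le_iff (v : Fin n → ℝ) (α y : ℝ) :
    quantile (ecdf v) α ≤ (y : EReal) ↔ α ≤ ecdf v y := by
  refine ⟨fun h => ?_, fun h => sInf_le ⟨y, h, rfl⟩⟩
  by_contra! hlt
  obtain ⟨t, ht, hyt⟩ := ((eventually_ecdf_eq v y).and self_mem_nhdsWithin).exists
  refine absurd h (not_le.2 (lt_of_lt_of_le (EReal.coe_lt_coe_iff.2 hyt) (le_sInf ?_)))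
  rintro _ ⟨x, hx, rfl⟩
  rw [EReal.coe_le_coe_iff]
  by_contra! hxt
  have := ecdf_mono v hxt.le
  rw [ht] at this
  exact absurd (lt_of_le_of_lt (le_trans hx this) hlt) (lt_irrefl _)

lemma le_quantile_ecdf_iff (v : Fin n → ℝ) (α y : ℝ) :
    (y : EReal) ≤ quantile (ecdf v) α ↔ ecdfLeft v y < α := by
  constructor
  · intro h
    by_contra! hle
    obtain ⟨t, ht, hty⟩ := ((eventually_ecdf_eq_ecdfLeft v y).and self_mem_nhdsWithin).exists
    have h1 : quantile (ecdf v) α ≤ (t : EReal) :=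
      sInf_le ⟨t, by rw [Set.mem_ofPred, ht]; exact hle, rfl⟩
    exact absurd (EReal.coe_le_coe_iff.1 (h.trans h1)) (not_le.2 hty)
  · intro h
    refine le_sInf ?_
    rintro _ ⟨x, hx, rfl⟩
    rw [EReal.coe_le_coe_iff]
    by_contra! hxy
    exact absurd (lt_of_le_of_lt (le_trans hx (ecdf_le_ecdfLeft v hxy)) h) (lt_irrefl _)

/-- In terms of the empirical distribution function of the Jackknife+ points the interval is
described without quantiles. -/
lemma mem_plusInterval_iff (A : Algorithm) {p : ℕ} (T : Fin n → Pair p) (δ α₁ α₂ : ℝ)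
    (x : Fin p → ℝ) (y : ℝ) :
    y ∈ plusInterval A T δ α₁ α₂ x ↔
      α₁ ≤ ecdf (plusPoint A T x) (y + δ) ∧ ecdfLeft (plusPoint A T x) (y - δ) < α₂ := by
  rw [plusInterval, Set.mem_ofPred, ← quantile_ecdf_le_iff, ← le_quantile_ecdf_iff, EReal.coe_add,
    EReal.coe_sub, EReal.sub_le_iff_le_add (Or.inl (EReal.coe_ne_bot _))
      (Or.inl (EReal.coe_ne_top _)), EReal.sub_le_iff_le_add (Or.inl (EReal.coe_ne_bot _))
      (Or.inl (EReal.coe_ne_top _))]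

end Quantile

/-! ### Distribution functions that are close in the Lévy distance -/

section Levy

variable {E : Type*} [MeasurableSpace E] {P : Measure E} [IsProbabilityMeasure P] {u : E → ℝ}
  {G : ℝ → ℝ} {δ η c α : ℝ}

/-- A shifted version of the fact that `G (u z)` is stochastically at least uniform when `G` is
the distribution function of `u`. -/
lemma measureReal_lt_le_of_levy (hG : Monotone G) (hG1 : ∃ b, 1 ≤ G b)
    (hH : ∀ t, P.real {z | u z ≤ t} ≤ G (t + δ) + η) (hη : 0 ≤ η) (hc : δ < c) (hα : 0 ≤ α) :
    P.real {z | G (u z + c) < α} ≤ α + η := by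
  rcases lt_or_ge 1 α with h1 | h1
  · linarith [measureReal_le_one (μ := P) (s := {z | G (u z + c) < α})]
  rcases Set.eq_empty_or_nonempty {t | G t < α} with h | hne
  · have : {z | G (u z + c) < α} = ∅ := by
      ext z
      have : u z + c ∉ {t | G t < α} := by rw [h]; simp
      simpa using this
    rw [this]; simp; positivity
  have hbdd : BddAbove {t | G t < α} := by
    obtain ⟨b, hb⟩ := hG1
    refine ⟨b, fun t ht => ?_⟩
    by_contra! hlt
    exact absurd (lt_of_le_of_lt (hb.trans (hG hlt.le)) ht) (not_lt.2 h1)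
  set q := sSup {t | G t < α}
  obtain ⟨s, hs, hqs⟩ := exists_lt_of_lt_csSup hne (show q - c + δ < q by linarith)
  calc P.real {z | G (u z + c) < α} ≤ P.real {z | u z ≤ q - c} :=
        measureReal_mono fun z hz => by
          have := le_csSup hbdd hz
          simp only [Set.mem_ofPred]; linarith
    _ ≤ G (q - c + δ) + η := hH _
    _ ≤ G s + η := by gcongr; exact hG hqs.le
    _ ≤ α + η := by have : G s < α := hs; linarith

/-- The companion lower bound: `G (u z)` is, after a shift, stochastically at most uniform. -/
lemma le_measureReal_lt_of_levy (hG : Monotone G) (hG0 : ∃ a, G a ≤ 0)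
    (hG1 : ∃ b, 1 ≤ G b) (hH : ∀ t, G t ≤ P.real {z | u z ≤ t + δ} + η) (hη : 0 ≤ η)
    (hc : δ < c) (hα : α ≤ 1) :
    α - η ≤ P.real {z | G (u z - c) < α} := by
  rcases le_or_gt α 0 with h0 | h0
  · linarith [measureReal_nonneg (μ := P) (s := {z | G (u z - c) < α})]
  have hne : Set.Nonempty {t | G t < α} := by
    obtain ⟨a, ha⟩ := hG0
    exact ⟨a, lt_of_le_of_lt ha h0⟩
  have hbdd : BddAbove {t | G t < α} := by
    obtain ⟨b, hb⟩ := hG1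
    refine ⟨b, fun t ht => ?_⟩
    by_contra! hlt
    exact absurd (lt_of_le_of_lt (hb.trans (hG hlt.le)) ht) (not_lt.2 hα)
  set q := sSup {t | G t < α}
  have ht : α ≤ G (q + (c - δ) / 2) := by
    by_contra! hlt
    have := le_csSup hbdd (show q + (c - δ) / 2 ∈ {t | G t < α} from hlt)
    linarith
  have hsub : P.real {z | u z ≤ q + (c - δ) / 2 + δ} ≤ P.real {z | G (u z - c) < α} := by
    refine measureReal_mono fun z hz => ?_
    simp only [Set.mem_ofPred] at hz ⊢
    obtain ⟨s, hs, hqs⟩ := exists_lt_of_lt_csSup hne (show q - (c - δ) / 2 < q by linarith)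
    exact lt_of_le_of_lt (hG (by linarith)) hs
  linarith [hH (q + (c - δ) / 2)]

end Levy

/-! ### Coverage for typical training data -/

section Coverage

variable {p n : ℕ}

/-- The proportion of leave-one-out predictions at `x` which differ from the prediction by at
least `δ`. -/
noncomputable def unstableFraction (A : Algorithm) (T : Fin n → Pair p) (δ : ℝ)
    (x : Fin p → ℝ) : ℝ :=
  (1 / (n : ℝ)) * ∑ i : Fin n,
    Set.indicator {d : ℝ | δ ≤ |d|} (fun _ => (1 : ℝ)) (A p n x T - looPredict A T i x)

/-- The residual of the pair `z` with respect to the predictor trained on `T`. -/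
def residual (A : Algorithm) (T : Fin n → Pair p) (z : Pair p) : ℝ := z.1 - A p n z.2 T

/-- Training data for which, up to `δ` and `η`, the leave-one-out residuals have the distribution
of the residual of a new pair, in the sense of the Lévy distance, and for which most
leave-one-out predictions of most new responses are within `δ` of the prediction. -/
structure IsTypical (A : Algorithm) (P : Measure (Pair p)) (δ η : ℝ) (T : Fin n → Pair p) :
    Prop where
  ecdf_le : ∀ t, ecdf (looResidual A T) t ≤ P.real {z | residual A T z ≤ t + δ} + η
  le_ecdf : ∀ t, P.real {z | residual A T z ≤ t} ≤ ecdf (looResidual A T) (t + δ) + η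
  unstable_le : P.real {z | η < unstableFraction A T δ z.2} ≤ η

/-- The Jackknife+ points differ from prediction plus residual by less than `δ`, except for the
unstable fraction of them. -/
lemma ecdf_plusPoint_le (A : Algorithm) (T : Fin n → Pair p) (δ c : ℝ) (z : Pair p) :
    ecdf (plusPoint A T z.2) (z.1 + c)
      ≤ ecdf (looResidual A T) (residual A T z + c + δ) + unstableFraction A T δ z.2 := by
  simp only [ecdf, unstableFraction, ← mul_add, ← Finset.sum_add_distrib]
  refine average_mono fun i => ?_
  by_cases h : δ ≤ |A p n z.2 T - looPredict A T i z.2|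
  · rw [Set.indicator_of_mem (s := {d : ℝ | δ ≤ |d|}) h]
    linarith [(indicator_one_mem_Icc (Set.Iic (z.1 + c)) (plusPoint A T z.2 i)).2,
      (indicator_one_mem_Icc (Set.Iic (residual A T z + c + δ)) (looResidual A T i)).1]
  · rw [Set.indicator_of_notMem (s := {d : ℝ | δ ≤ |d|}) h, add_zero]
    refine indicator_one_le_indicator_one fun hx => ?_
    have h := abs_lt.1 (not_le.1 h)
    simp only [Set.mem_Iic, plusPoint, residual] at hx ⊢
    linarith [h.1, h.2]

lemma le_ecdf_plusPoint (A : Algorithm) (T : Fin n → Pair p) (δ c : ℝ) (z : Pair p) :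
    ecdf (looResidual A T) (residual A T z + c - δ)
      ≤ ecdf (plusPoint A T z.2) (z.1 + c) + unstableFraction A T δ z.2 := by
  simp only [ecdf, unstableFraction, ← mul_add, ← Finset.sum_add_distrib]
  refine average_mono fun i => ?_
  by_cases h : δ ≤ |A p n z.2 T - looPredict A T i z.2|
  · rw [Set.indicator_of_mem (s := {d : ℝ | δ ≤ |d|}) h]
    linarith [(indicator_one_mem_Icc (Set.Iic (z.1 + c)) (plusPoint A T z.2 i)).1,
      (indicator_one_mem_Icc (Set.Iic (residual A T z + c - δ)) (looResidual A T i)).2]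
  · rw [Set.indicator_of_notMem (s := {d : ℝ | δ ≤ |d|}) h, add_zero]
    refine indicator_one_le_indicator_one fun hx => ?_
    have h := abs_lt.1 (not_le.1 h)
    simp only [Set.mem_Iic, plusPoint, residual] at hx ⊢
    linarith [h.1, h.2]

variable {A : Algorithm} {P : Measure (Pair p)} [IsProbabilityMeasure P] {δ η : ℝ}
  {T : Fin n → Pair p}

/-- For typical training data the enlarged interval covers with at least the nominal
probability. -/
lemma IsTypical.le_coverage (hT : IsTypical A P δ η T) (hn : 0 < n) (hδ : 0 < δ) (hη : 0 ≤ η)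
    {α₁ α₂ : ℝ} (h₁ : 0 ≤ α₁) (h₂ : α₂ ≤ 1) :
    α₂ - α₁ - 5 * η ≤ P.real {z | z.1 ∈ plusInterval A T (4 * δ) α₁ α₂ z.2} := by
  set G := ecdf (looResidual A T)
  have c1 := measureReal_lt_le_of_levy (c := 3 * δ) (α := α₁ + η) (ecdf_mono _)
    (exists_one_le_ecdf hn _) hT.le_ecdf hη (by linarith) (by linarith)
  have c2 := le_measureReal_lt_of_levy (c := 3 * δ) (α := α₂ - η) (ecdf_mono _)
    (exists_ecdf_nonpos _) (exists_one_le_ecdf hn _) hT.ecdf_le hη (by linarith) (by linarith)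
  -- passing from Jackknife+ points to residuals uses up `δ` of the shift `4 * δ`
  have hsub : {z | G (residual A T z - 3 * δ) < α₂ - η} ⊆
      {z | z.1 ∈ plusInterval A T (4 * δ) α₁ α₂ z.2}
        ∪ {z | G (residual A T z + 3 * δ) < α₁ + η}
        ∪ {z | η < unstableFraction A T δ z.2} := by
    intro z hz
    simp only [Set.mem_ofPred, Set.mem_union, mem_plusInterval_iff] at hz ⊢
    by_contra! hcon
    obtain ⟨⟨h1, h2⟩, h3⟩ := hcon
    have a1 := le_ecdf_plusPoint A T δ (4 * δ) z
    have a2 := ecdf_plusPoint_le A T δ (-(4 * δ)) z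
    have e1 : residual A T z + 4 * δ - δ = residual A T z + 3 * δ := by ring
    have e2 : residual A T z + -(4 * δ) + δ = residual A T z - 3 * δ := by ring
    rw [e1] at a1
    rw [e2, ← sub_eq_add_neg] at a2
    have a3 := ecdfLeft_le_ecdf (plusPoint A T z.2) (z.1 - 4 * δ)
    have := h1 (by linarith)
    linarith
  have := (measureReal_mono (μ := P) hsub).trans (measureReal_union_le _ _)
  have := this.trans (add_le_add_left (measureReal_union_le _ _) _)
  linarith [hT.unstable_le]

/-- For typical training data the shrunk interval covers with at most the nominal probability. -/
lemma IsTypical.coverage_le (hA : A.IsMeasurable) (hT : IsTypical A P δ η T) (hn : 0 < n)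
    (hδ : 0 < δ) (hη : 0 ≤ η) {α₁ α₂ : ℝ} (h₁ : 0 ≤ α₁) (h₁₂ : α₁ ≤ α₂) (h₂ : α₂ ≤ 1) :
    P.real {z | z.1 ∈ plusInterval A T (-(4 * δ)) α₁ α₂ z.2} ≤ α₂ - α₁ + 5 * η := by
  set G := ecdf (looResidual A T)
  have hGm : Monotone G := ecdf_mono _
  have hr : Measurable (residual A T) := by
    have : Measurable fun z : Pair p => (z.2, T) := by fun_prop
    exact measurable_fst.sub ((hA p n).comp this)
  have c1 := measureReal_lt_le_of_levy (c := 2 * δ) (α := α₂ + η) (ecdf_mono _)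
    (exists_one_le_ecdf hn _) hT.le_ecdf hη (by linarith) (by linarith)
  have c2 := le_measureReal_lt_of_levy (c := 2 * δ) (α := α₁ - η) (ecdf_mono _)
    (exists_ecdf_nonpos _) (exists_one_le_ecdf hn _) hT.ecdf_le hη (by linarith) (by linarith)
  set B := {z | G (residual A T z + 2 * δ) < α₂ + η}
  set C := {z | G (residual A T z - 2 * δ) < α₁ - η}
  -- besides the shift by `δ`, another `δ` is spent on replacing `ecdfLeft` by `ecdf`
  have hsub : {z | z.1 ∈ plusInterval A T (-(4 * δ)) α₁ α₂ z.2} ⊆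
      B \ C ∪ {z | η < unstableFraction A T δ z.2} := by
    intro z hz
    simp only [Set.mem_ofPred, Set.mem_union, Set.mem_sdiff, mem_plusInterval_iff, B, C] at hz ⊢
    by_contra! hcon
    obtain ⟨h1, h2⟩ := hz
    obtain ⟨h3, h4⟩ := hcon
    have a1 := ecdf_plusPoint_le A T δ (-(4 * δ)) z
    have a2 := le_ecdf_plusPoint A T δ (3 * δ) z
    have e1 : residual A T z + 3 * δ - δ = residual A T z + 2 * δ := by ring
    have e2 : residual A T z + -(4 * δ) + δ ≤ residual A T z - 2 * δ := by linarith
    rw [e1] at a2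
    have a3 := ecdf_le_ecdfLeft (plusPoint A T z.2)
      (show z.1 + 3 * δ < z.1 - -(4 * δ) by linarith)
    have a4 := hGm e2
    have := h3 (by linarith)
    linarith
  have hle := (measureReal_mono (μ := P) hsub).trans (measureReal_union_le _ _)
  have hmC : MeasurableSet C :=
    (hGm.measurable.comp (hr.sub_const _)) measurableSet_Iio
  have hdiff : P.real (B \ C) ≤ α₂ - α₁ + 4 * η := by
    -- both sets are sublevel sets of the residual, hence one contains the other
    by_cases hBC : B ⊆ C
    · rw [Set.sdiff_eq_empty.2 hBC]; simp; linarith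
    · have hCB : C ⊆ B := by
        obtain ⟨z, hzB, hzC⟩ := Set.not_subset.1 hBC
        intro w hw
        have hwz : residual A T w < residual A T z := by
          by_contra! hle
          exact hzC (lt_of_le_of_lt (hGm (by linarith)) hw)
        exact lt_of_le_of_lt (hGm (by linarith)) hzB
      rw [measureReal_sdiff hCB hmC]
      linarith
  linarith [hT.unstable_le]

end Coverage

/-! ### Measurability of predictions and residuals -/

section Measurability

variable {p n : ℕ} {A : Algorithm}

/-- The data without the `i`-th pair do not depend on that pair. -/
lemma leaveOut_update (T : Fin n → Pair p) (i : Fin n) (z : Pair p) :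
    leaveOut (Function.update T i z) i = leaveOut T i := by
  funext j
  unfold leaveOut
  split_ifs with h
  · rw [Function.update_of_ne]
    intro h'
    rw [← h'] at h
    exact lt_irrefl _ h
  · rw [Function.update_of_ne]
    intro h'
    rw [← h'] at h
    exact h (Nat.lt_succ_self _)

lemma measurable_leaveOut (i : Fin n) :
    Measurable fun T : Fin n → Pair p => leaveOut T i := by
  refine measurable_pi_lambda _ fun j => ?_
  unfold leaveOut
  split_ifs <;> fun_prop

lemma Algorithm.IsMeasurable.predict (hA : A.IsMeasurable) :
    Measurable fun q : (Fin n → Pair p) × Pair p => A p n q.2.2 q.1 := by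
  have : Measurable fun q : (Fin n → Pair p) × Pair p => (q.2.2, q.1) := by fun_prop
  exact (hA p n).comp this

lemma Algorithm.IsMeasurable.looPredict (hA : A.IsMeasurable) (i : Fin n) :
    Measurable fun q : (Fin n → Pair p) × Pair p => looPredict A q.1 i q.2.2 := by
  have : Measurable fun q : (Fin n → Pair p) × Pair p => (q.2.2, leaveOut q.1 i) :=
    (by fun_prop : Measurable fun q : (Fin n → Pair p) × Pair p => q.2.2).prodMk
      ((measurable_leaveOut i).comp measurable_fst)
  exact (hA p (n - 1)).comp this

lemma Algorithm.IsMeasurable.residual (hA : A.IsMeasurable) :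
    Measurable fun q : (Fin n → Pair p) × Pair p => residual A q.1 q.2 :=
  (by fun_prop : Measurable fun q : (Fin n → Pair p) × Pair p => q.2.1).sub hA.predict

lemma Algorithm.IsMeasurable.unstableFraction (hA : A.IsMeasurable) (δ : ℝ) :
    Measurable fun q : (Fin n → Pair p) × Pair p => unstableFraction A q.1 δ q.2.2 := by
  refine Measurable.const_mul (Finset.measurable_sum _ fun i _ => ?_) _
  have hm : Measurable (Set.indicator {d : ℝ | δ ≤ |d|} fun _ => (1 : ℝ)) :=
    measurable_const.indicator (measurableSet_le measurable_const measurable_id.abs)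
  exact hm.comp (hA.predict.sub (hA.looPredict i))

end Measurability

/-! ### Ramp functions and closeness on a grid -/

section Ramp

/-- The piecewise linear function which equals `1` up to `t` and `0` from `t + δ` on. -/
noncomputable def ramp (t δ u : ℝ) : ℝ := max 0 (min 1 ((t + δ - u) / δ))

variable {t δ u v : ℝ}

lemma ramp_mem_Icc : ramp t δ u ∈ Set.Icc (0 : ℝ) 1 :=
  ⟨le_max_left _ _, max_le zero_le_one (min_le_left _ _)⟩

lemma measurable_ramp : Measurable (ramp t δ) := by
  unfold ramp; fun_prop

lemma indicator_le_ramp (hδ : 0 < δ) :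
    Set.indicator (Set.Iic t) (fun _ => (1 : ℝ)) u ≤ ramp t δ u := by
  by_cases h : u ≤ t
  · rw [Set.indicator_of_mem (Set.mem_Iic.2 h)]
    refine le_max_of_le_right (le_min le_rfl ?_)
    rw [le_div_iff₀ hδ]; linarith
  · rw [Set.indicator_of_notMem (fun h' => h (Set.mem_Iic.1 h'))]
    exact ramp_mem_Icc.1

lemma ramp_le_indicator (hδ : 0 < δ) :
    ramp t δ u ≤ Set.indicator (Set.Iic (t + δ)) (fun _ => (1 : ℝ)) u := by
  by_cases h : u ≤ t + δ
  · rw [Set.indicator_of_mem (Set.mem_Iic.2 h)]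
    exact ramp_mem_Icc.2
  · rw [Set.indicator_of_notMem (fun h' => h (Set.mem_Iic.1 h'))]
    refine max_le le_rfl ((min_le_right _ _).trans ?_)
    exact div_nonpos_of_nonpos_of_nonneg (by linarith [not_le.1 h]) hδ.le

lemma abs_ramp_sub_le (hδ : 0 < δ) : |ramp t δ u - ramp t δ v| ≤ |u - v| / δ := by
  unfold ramp
  calc _ ≤ |min 1 ((t + δ - u) / δ) - min 1 ((t + δ - v) / δ)| := by
        have := abs_max_sub_max_le_max 0 (min 1 ((t + δ - u) / δ)) 0 (min 1 ((t + δ - v) / δ))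
        simpa using this
    _ ≤ |(t + δ - u) / δ - (t + δ - v) / δ| := by
        have := abs_min_sub_min_le_max 1 ((t + δ - u) / δ) 1 ((t + δ - v) / δ)
        simpa using this
    _ = |u - v| / δ := by
        rw [← sub_div, abs_div, abs_of_pos hδ]
        congr 1
        rw [show t + δ - u - (t + δ - v) = -(u - v) by ring, abs_neg]

end Ramp

/-- For distribution functions, closeness on a sufficiently long finite grid with spacing `δ`
is enough for closeness everywhere. -/
lemma levy_of_grid {G H : ℝ → ℝ} (hG : Monotone G) (hH : Monotone H)
    (G01 : ∀ t, G t ∈ Set.Icc (0 : ℝ) 1) (H01 : ∀ t, H t ∈ Set.Icc (0 : ℝ) 1) {a δ η : ℝ} {K : ℕ}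
    (hδ : 0 < δ) (hη : 0 ≤ η)
    (h1 : ∀ k ∈ Finset.range (K + 1), G (a + k * δ) ≤ H (a + k * δ + δ) + η)
    (h2 : ∀ k ∈ Finset.range (K + 1), H (a + k * δ) ≤ G (a + k * δ + δ) + η)
    (hlow : H (a + δ) ≤ η) (hhigh : 1 - η ≤ H (a + K * δ)) (t : ℝ) :
    G t ≤ H (t + 2 * δ) + 2 * η ∧ H t ≤ G (t + 2 * δ) + 2 * η := by
  rcases lt_or_ge t a with hta | hta
  · have e1 := h1 0 (by simp)
    simp only [Nat.cast_zero, zero_mul, add_zero] at e1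
    have e2 := hG hta.le
    have e3 := hH (show t ≤ a + δ by linarith)
    exact ⟨by linarith [(H01 (t + 2 * δ)).1], by linarith [(G01 (t + 2 * δ)).1]⟩
  rcases le_or_gt (a + K * δ) t with htb | htb
  · have e1 := h2 K (by simp)
    have e2 := hH (show a + K * δ ≤ t + 2 * δ by linarith)
    have e3 := hG (show a + K * δ + δ ≤ t + 2 * δ by linarith)
    exact ⟨by linarith [(G01 t).2], by linarith [(H01 t).2]⟩
  have hx : 0 ≤ (t - a) / δ := div_nonneg (by linarith) hδ.le
  set k := ⌊(t - a) / δ⌋₊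
  have k1 : a + k * δ ≤ t := by
    have := Nat.floor_le hx
    rw [le_div_iff₀ hδ] at this; linarith
  have k2 : t < a + ((k + 1 : ℕ) : ℝ) * δ := by
    have := Nat.lt_floor_add_one ((t - a) / δ)
    rw [div_lt_iff₀ hδ] at this; push_cast; linarith
  have k3 : k < K := by
    have : (k : ℝ) < K := by
      by_contra! hle
      have := mul_le_mul_of_nonneg_right hle hδ.le
      linarith
    exact_mod_cast this
  have e1 := h1 (k + 1) (by simp; omega)
  have e2 := h2 (k + 1) (by simp; omega)
  have k4 : a + ((k + 1 : ℕ) : ℝ) * δ + δ ≤ t + 2 * δ := by push_cast; linarith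
  exact ⟨by linarith [hG k2.le, hH k4], by linarith [hH k2.le, hG k4]⟩

/-! ### The probability of typical training data -/

section Bounds

lemma measureReal_ge_le_div {Ω : Type*} [MeasurableSpace Ω] {μ : Measure Ω} [IsFiniteMeasure μ]
    {f : Ω → ℝ} (hf : Measurable f) {C : ℝ} (h0 : ∀ x, 0 ≤ f x) (hC : ∀ x, f x ≤ C) {η : ℝ}
    (hη : 0 < η) : μ.real {x | η ≤ f x} ≤ (∫ x, f x ∂μ) / η := by
  rw [le_div_iff₀ hη, mul_comm]
  exact mul_meas_ge_le_integral_of_nonneg (ae_of_all _ h0)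
    (integrable_of_abs_le hf (C := C) fun x => by rw [abs_of_nonneg (h0 x)]; exact hC x) η

lemma integral_measureReal_prodMk {α β : Type*} [MeasurableSpace α] [MeasurableSpace β]
    (μ : Measure α) (ν : Measure β) [IsProbabilityMeasure μ] [IsProbabilityMeasure ν]
    {S : Set (α × β)} (hS : MeasurableSet S) :
    ∫ x, ν.real (Prod.mk x ⁻¹' S) ∂μ = (μ.prod ν).real S := by
  rw [← integral_indicator_one hS, integral_prod _ ((integrable_const _).indicator hS)]
  refine integral_congr_ae (ae_of_all _ fun x => ?_)
  simp only
  rw [← integral_indicator_one (measurable_prodMk_left hS)]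
  rfl

lemma measurable_measureReal_prodMk {α β : Type*} [MeasurableSpace α] [MeasurableSpace β]
    (ν : Measure β) [IsProbabilityMeasure ν] {S : Set (α × β)} (hS : MeasurableSet S) :
    Measurable fun x => ν.real (Prod.mk x ⁻¹' S) :=
  (measurable_measure_prodMk_left hS).ennreal_toReal

lemma integral_indicator_residual {p n : ℕ} {A : Algorithm} (hA : A.IsMeasurable)
    (P : Measure (Pair p)) (t : ℝ) (T : Fin n → Pair p) :
    ∫ z, Set.indicator (Set.Iic t) (fun _ => (1 : ℝ)) (residual A T z) ∂P
      = P.real {z | residual A T z ≤ t} := by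
  have hr : Measurable (residual A T) := hA.residual.comp measurable_prodMk_left
  exact integral_indicator_one (hr measurableSet_Iic)

variable {p n : ℕ} (A : Algorithm) (P : Measure (Pair p)) [IsProbabilityMeasure P]

/-- The average probability that a leave-one-out prediction differs from the prediction by at
least `ε`, for a sample from `P` and an independent new pair. -/
noncomputable def instability (n : ℕ) (ε : ℝ) : ℝ :=
  (1 / (n : ℝ)) * ∑ i : Fin n, ((Measure.pi fun _ : Fin n => P).prod P).real
    {q | ε ≤ |A p n q.2.2 q.1 - looPredict A q.1 i q.2.2|}

/-- The difference between the average of the ramp function over the leave-one-out residuals and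
its conditional expectation at the residual of a new pair. -/
noncomputable def rampError (t δ : ℝ) (T : Fin n → Pair p) : ℝ :=
  |(1 / (n : ℝ)) * ∑ i, ramp t δ (looResidual A T i) - ∫ z, ramp t δ (residual A T z) ∂P|

variable {A P}

lemma measurableSet_unstable (hA : A.IsMeasurable) (i : Fin n) (ε : ℝ) :
    MeasurableSet {q : (Fin n → Pair p) × Pair p |
      ε ≤ |A p n q.2.2 q.1 - looPredict A q.1 i q.2.2|} :=
  measurableSet_le measurable_const (hA.predict.sub (hA.looPredict i)).abs

lemma meanDist_ramp_le (hA : A.IsMeasurable) {t δ ε : ℝ} (hδ : 0 < δ) (hε : 0 < ε) (i : Fin n) :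
    meanDist P (fun T z => ramp t δ (residual A T z))
        (fun T z => ramp t δ (z.1 - looPredict A T i z.2))
      ≤ ε / δ + ((Measure.pi fun _ : Fin n => P).prod P).real
        {q | ε ≤ |A p n q.2.2 q.1 - looPredict A q.1 i q.2.2|} := by
  have hS := measurableSet_unstable hA (p := p) i ε
  set S := {q : (Fin n → Pair p) × Pair p | ε ≤ |A p n q.2.2 q.1 - looPredict A q.1 i q.2.2|}
  have hi : Integrable (S.indicator fun _ => (1 : ℝ)) ((Measure.pi fun _ : Fin n => P).prod P) :=
    (integrable_const _).indicator hS
  have e : ((Measure.pi fun _ : Fin n => P).prod P).real S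
      = ∫ q, S.indicator (fun _ => (1 : ℝ)) q ∂((Measure.pi fun _ : Fin n => P).prod P) :=
    (integral_indicator_one hS).symm
  have e' : ε / δ = ∫ _, ε / δ ∂((Measure.pi fun _ : Fin n => P).prod P) := by simp
  rw [e, e', ← integral_add (integrable_const _) hi, meanDist]
  refine integral_mono_of_nonneg (ae_of_all _ fun _ => abs_nonneg _)
    ((integrable_const _).add hi) (ae_of_all _ fun q => ?_)
  simp only
  by_cases hq : q ∈ S
  · rw [Set.indicator_of_mem hq]
    have := abs_sub_le_one_of_mem_Icc (ramp_mem_Icc (t := t) (δ := δ) (u := residual A q.1 q.2))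
      (ramp_mem_Icc (t := t) (δ := δ) (u := q.2.1 - looPredict A q.1 i q.2.2))
    have := div_nonneg hε.le hδ.le
    linarith
  · rw [Set.indicator_of_notMem hq, add_zero]
    refine (abs_ramp_sub_le hδ).trans (div_le_div_of_nonneg_right ?_ hδ.le)
    have hq' : |A p n q.2.2 q.1 - looPredict A q.1 i q.2.2| < ε := not_le.1 hq
    rw [residual, show q.2.1 - A p n q.2.2 q.1 - (q.2.1 - looPredict A q.1 i q.2.2)
      = -(A p n q.2.2 q.1 - looPredict A q.1 i q.2.2) by ring, abs_neg]
    exact hq'.le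

lemma integral_rampError_le (hA : A.IsMeasurable) (hn : 0 < n) {t δ ε c : ℝ} (hδ : 0 < δ)
    (hε : 0 < ε) (hc : 0 < c) :
    ∫ T, rampError A P t δ T ∂(Measure.pi fun _ : Fin n => P)
      ≤ (ε / δ + instability A P n ε) + c
        + (1 / (n : ℝ) + 8 * (ε / δ + instability A P n ε)) / c := by
  have : Nonempty (Fin n) := ⟨⟨0, hn⟩⟩
  have hr : Measurable (Function.uncurry fun (T : Fin n → Pair p) z =>
      ramp t δ (residual A T z)) := measurable_ramp.comp hA.residual
  have hl : ∀ i, Measurable (Function.uncurry fun (T : Fin n → Pair p) (z : Pair p) =>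
      ramp t δ (z.1 - looPredict A T i z.2)) := fun i =>
    measurable_ramp.comp ((by fun_prop :
      Measurable fun q : (Fin n → Pair p) × Pair p => q.2.1).sub (hA.looPredict i))
  have key := integral_abs_average_loss_sub_le (P := P) (c := c)
    (s := ε / δ + instability A P n ε) hr hl
    (fun _ _ => ramp_mem_Icc) (fun _ _ _ => ramp_mem_Icc)
    (fun i T z' z => by simp only [looPredict, leaveOut_update]) hc (by
      rw [instability, Fintype.card_fin]
      refine (average_mono fun i => meanDist_ramp_le hA hδ hε i).trans (le_of_eq ?_)
      rw [Finset.sum_add_distrib]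
      have : (n : ℝ) ≠ 0 := by positivity
      simp only [Finset.sum_const, Finset.card_univ, Fintype.card_fin, nsmul_eq_mul]
      field_simp)
  rw [Fintype.card_fin] at key
  exact key

lemma measurable_rampError (hA : A.IsMeasurable) (t δ : ℝ) :
    Measurable (rampError A P t δ : (Fin n → Pair p) → ℝ) := by
  refine Measurable.abs (Measurable.sub (Measurable.const_mul
    (Finset.measurable_sum _ fun i _ => measurable_ramp.comp ?_) _)
    (measurable_integral_right (r := fun (T : Fin n → Pair p) z => ramp t δ (residual A T z))
      (measurable_ramp.comp hA.residual)))
  have : Measurable fun T : Fin n → Pair p => (T, T i) := by fun_prop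
  exact (by fun_prop : Measurable fun T : Fin n → Pair p => (T i).1).sub
    ((hA.looPredict i).comp this)

lemma integral_ramp_mem_Icc (hA : A.IsMeasurable) (t δ : ℝ) (T : Fin n → Pair p) :
    ∫ z, ramp t δ (residual A T z) ∂P ∈ Set.Icc (0 : ℝ) 1 :=
  integral_mem_Icc (measurable_ramp.comp (hA.residual.comp measurable_prodMk_left))
    fun _ => ramp_mem_Icc

lemma rampError_le_one (hA : A.IsMeasurable) (t δ : ℝ) (T : Fin n → Pair p) :
    rampError A P t δ T ≤ 1 :=
  abs_sub_le_one_of_mem_Icc (average_mem_Icc fun _ => ramp_mem_Icc) (integral_ramp_mem_Icc hA t δ T)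

lemma integrable_indicator_residual (hA : A.IsMeasurable) (t : ℝ) (T : Fin n → Pair p) :
    Integrable (fun z => Set.indicator (Set.Iic t) (fun _ => (1 : ℝ)) (residual A T z)) P := by
  have hr : Measurable (residual A T) := hA.residual.comp measurable_prodMk_left
  refine integrable_of_abs_le (C := 1)
    ((measurable_const.indicator measurableSet_Iic).comp hr) fun z => ?_
  rw [abs_of_nonneg (indicator_one_mem_Icc _ _).1]
  exact (indicator_one_mem_Icc _ _).2

lemma integrable_ramp_residual (hA : A.IsMeasurable) (t δ : ℝ) (T : Fin n → Pair p) :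
    Integrable (fun z => ramp t δ (residual A T z)) P := by
  have hr : Measurable (residual A T) := hA.residual.comp measurable_prodMk_left
  refine integrable_of_abs_le (C := 1) (measurable_ramp.comp hr) fun z => ?_
  rw [abs_of_nonneg ramp_mem_Icc.1]
  exact ramp_mem_Icc.2

lemma ecdf_le_of_rampError_le (hA : A.IsMeasurable) {t δ η : ℝ} (hδ : 0 < δ) {T : Fin n → Pair p}
    (h : rampError A P t δ T ≤ η) :
    ecdf (looResidual A T) t ≤ P.real {z | residual A T z ≤ t + δ} + η := by
  have h1 : ecdf (looResidual A T) t ≤ (1 / (n : ℝ)) * ∑ i, ramp t δ (looResidual A T i) :=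
    average_mono fun i => indicator_le_ramp hδ
  have h2 : ∫ z, ramp t δ (residual A T z) ∂P ≤ P.real {z | residual A T z ≤ t + δ} := by
    rw [← integral_indicator_residual hA]
    exact integral_mono (integrable_ramp_residual hA _ _ _) (integrable_indicator_residual hA _ _)
      fun z => ramp_le_indicator hδ
  linarith [(abs_le.1 h).2]

lemma le_ecdf_of_rampError_le (hA : A.IsMeasurable) {t δ η : ℝ} (hδ : 0 < δ) {T : Fin n → Pair p}
    (h : rampError A P t δ T ≤ η) :
    P.real {z | residual A T z ≤ t} ≤ ecdf (looResidual A T) (t + δ) + η := by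
  have h1 : (1 / (n : ℝ)) * ∑ i, ramp t δ (looResidual A T i) ≤ ecdf (looResidual A T) (t + δ) :=
    average_mono fun i => ramp_le_indicator hδ
  have h2 : P.real {z | residual A T z ≤ t} ≤ ∫ z, ramp t δ (residual A T z) ∂P := by
    rw [← integral_indicator_residual hA]
    exact integral_mono (integrable_indicator_residual hA _ _) (integrable_ramp_residual hA _ _ _)
      fun z => indicator_le_ramp hδ
  linarith [(abs_le.1 h).1]

/-- Typicality follows from finitely many conditions, each of which Markov's inequality shows to
hold with high probability. The grid starts below `-M` and ends above `M`, beyond which the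
distribution function of the prediction error is within `η` of its limits. -/
lemma isTypical_of_forall_grid (hA : A.IsMeasurable) {δ η M : ℝ} {K : ℕ} (hδ : 0 < δ) (hη : 0 < η)
    (hK : 2 * M + δ + 1 ≤ K * δ) {T : Fin n → Pair p}
    (h1 : ∀ k ∈ Finset.range (K + 1), rampError A P (-M - δ - 1 + k * δ) δ T ≤ η)
    (h2 : P.real {z | M < |residual A T z|} ≤ η)
    (h3 : P.real {z | η < unstableFraction A T δ z.2} ≤ η) :
    IsTypical A P (2 * δ) (2 * η) T := by
  have hr : Measurable (residual A T) := hA.residual.comp measurable_prodMk_left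
  have hlow : P.real {z | residual A T z ≤ -M - δ - 1 + δ} ≤ η :=
    (measureReal_mono fun z hz => by
      simp only [Set.mem_ofPred] at hz ⊢
      exact lt_of_lt_of_le (by linarith) (neg_le_abs _)).trans h2
  have hhigh : 1 - η ≤ P.real {z | residual A T z ≤ -M - δ - 1 + K * δ} := by
    have hc : P.real {z | residual A T z ≤ -M - δ - 1 + K * δ}ᶜ ≤ η :=
      (measureReal_mono fun z hz => by
        simp only [Set.mem_compl_iff, Set.mem_ofPred, not_le] at hz ⊢
        exact lt_of_lt_of_le (by linarith) (le_abs_self _)).trans h2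
    have hm : MeasurableSet {z | residual A T z ≤ -M - δ - 1 + K * δ} := hr measurableSet_Iic
    rw [probReal_compl_eq_one_sub hm] at hc
    linarith
  have key := levy_of_grid (G := ecdf (looResidual A T))
    (H := fun t => P.real {z | residual A T z ≤ t}) (ecdf_mono _)
    (fun s t hst => measureReal_mono fun z hz => le_trans hz hst)
    (ecdf_mem_Icc _) (fun t => ⟨measureReal_nonneg, measureReal_le_one⟩) hδ hη.le
    (fun k hk => ecdf_le_of_rampError_le hA hδ (h1 k hk))
    (fun k hk => le_ecdf_of_rampError_le hA hδ (h1 k hk)) hlow hhigh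
  refine ⟨fun t => (key t).1, fun t => (key t).2, ?_⟩
  have : P.real {z | 2 * η < unstableFraction A T (2 * δ) z.2} ≤ η := by
    refine (measureReal_mono fun z hz => ?_).trans h3
    have hz : 2 * η < unstableFraction A T (2 * δ) z.2 := hz
    have hle : unstableFraction A T (2 * δ) z.2 ≤ unstableFraction A T δ z.2 :=
      average_mono fun i => indicator_one_le_indicator_one fun hd => by
        have hd : 2 * δ ≤ _ := hd
        exact le_trans (by linarith) hd
    show η < _
    linarith
  linarith

lemma unstableFraction_mem_Icc (T : Fin n → Pair p) (δ : ℝ) (x : Fin p → ℝ) :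
    unstableFraction A T δ x ∈ Set.Icc (0 : ℝ) 1 :=
  average_mem_Icc fun _ => indicator_one_mem_Icc _ _

lemma integral_unstableFraction (hA : A.IsMeasurable) (δ : ℝ) :
    ∫ q : (Fin n → Pair p) × Pair p, unstableFraction A q.1 δ q.2.2
      ∂((Measure.pi fun _ : Fin n => P).prod P) = instability A P n δ := by
  unfold unstableFraction instability
  rw [integral_const_mul, integral_finsetSum]
  · congr 1
    refine Finset.sum_congr rfl fun i _ => ?_
    rw [← integral_indicator_one (measurableSet_unstable hA i δ)]
    rfl
  · intro i _
    exact (integrable_const (1 : ℝ)).indicator (measurableSet_unstable hA i δ)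

lemma measureReal_not_isTypical_le (hA : A.IsMeasurable) {δ η M : ℝ} {K : ℕ} (hδ : 0 < δ)
    (hη : 0 < η) (hK : 2 * M + δ + 1 ≤ K * δ) :
    (Measure.pi fun _ : Fin n => P).real {T | ¬ IsTypical A P (2 * δ) (2 * η) T}
      ≤ ∑ k ∈ Finset.range (K + 1),
          (∫ T, rampError A P (-M - δ - 1 + k * δ) δ T ∂(Measure.pi fun _ : Fin n => P)) / η
        + ((Measure.pi fun _ : Fin n => P).prod P).real {q | M < |residual A q.1 q.2|} / η
        + instability A P n δ / η / η := by
  set N := Measure.pi fun _ : Fin n => P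
  have hS : MeasurableSet {q : (Fin n → Pair p) × Pair p | M < |residual A q.1 q.2|} :=
    measurableSet_lt measurable_const hA.residual.abs
  have hR : MeasurableSet {q : (Fin n → Pair p) × Pair p | η < unstableFraction A q.1 δ q.2.2} :=
    measurableSet_lt measurable_const (hA.unstableFraction δ)
  have hsub : {T : Fin n → Pair p | ¬ IsTypical A P (2 * δ) (2 * η) T} ⊆
      (⋃ k ∈ Finset.range (K + 1), {T | η ≤ rampError A P (-M - δ - 1 + k * δ) δ T})
        ∪ {T | η ≤ P.real {z | M < |residual A T z|}}
        ∪ {T | η ≤ P.real {z | η < unstableFraction A T δ z.2}} := by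
    intro T hT
    by_contra hcon
    simp only [Set.mem_union, Set.mem_iUnion, Set.mem_ofPred, not_or, not_exists, not_le] at hcon
    exact hT (isTypical_of_forall_grid hA hδ hη hK (fun k hk => (hcon.1.1 k hk).le) hcon.1.2.le
      hcon.2.le)
  refine (measureReal_mono hsub).trans ((measureReal_union_le _ _).trans (add_le_add
    ((measureReal_union_le _ _).trans (add_le_add ((measureReal_biUnion_finset_le _ _).trans
      (Finset.sum_le_sum fun k _ => ?_)) ?_)) ?_))
  · exact measureReal_ge_le_div (measurable_rampError hA _ _) (fun _ => abs_nonneg _)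
      (rampError_le_one hA _ _) hη
  · rw [← integral_measureReal_prodMk N P hS]
    exact measureReal_ge_le_div (measurable_measureReal_prodMk P hS) (fun _ => measureReal_nonneg)
      (fun _ => measureReal_le_one) hη
  · refine (measureReal_ge_le_div (measurable_measureReal_prodMk P hR)
      (fun _ => measureReal_nonneg) (fun _ => measureReal_le_one) hη).trans ?_
    rw [integral_measureReal_prodMk N P hR, ← integral_unstableFraction hA]
    refine div_le_div_of_nonneg_right ?_ hη.le
    refine (measureReal_mono fun q (hq : η < _) => ?_).trans
      (measureReal_ge_le_div (hA.unstableFraction δ) (fun q => (unstableFraction_mem_Icc _ _ _).1)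
        (fun q => (unstableFraction_mem_Icc _ _ _).2) hη)
    exact hq.le

end Bounds

/-! ### Typical training data asymptotically -/

section Asymptotics

variable {A : Algorithm} {p : ℕ → ℕ} {P : ∀ n, Measure (Pair (p n))}
  [∀ n, IsProbabilityMeasure (P n)]

lemma tendsto_integral_rampError (hA : A.IsMeasurable)
    (hst : ∀ ε : ℝ, 0 < ε → Tendsto (fun n => instability A (P n) n ε) atTop (𝓝 0)) (t : ℝ)
    {δ : ℝ} (hδ : 0 < δ) :
    Tendsto (fun n => ∫ T, rampError A (P n) t δ T ∂(Measure.pi fun _ : Fin n => P n)) atTop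
      (𝓝 0) := by
  have hnn : ∀ n, 0 ≤ ∫ T, rampError A (P n) t δ T ∂(Measure.pi fun _ : Fin n => P n) :=
    fun n => integral_nonneg fun T => abs_nonneg _
  rw [Metric.tendsto_nhds]
  intro e he
  -- with `c = b` and `ε = b ^ 2 * δ` the bound for the integral tends to `b ^ 2 + 9 * b < e`
  obtain ⟨b, hb0, hb1, hbe⟩ : ∃ b : ℝ, 0 < b ∧ b ≤ 1 ∧ 11 * b ≤ e :=
    ⟨min 1 (e / 11), by positivity, min_le_left _ _, by
      have := min_le_right 1 (e / 11); linarith⟩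
  have hε : 0 < b ^ 2 * δ := by positivity
  have hlim : Tendsto (fun n : ℕ => (b ^ 2 * δ / δ + instability A (P n) n (b ^ 2 * δ)) + b
      + (1 / (n : ℝ) + 8 * (b ^ 2 * δ / δ + instability A (P n) n (b ^ 2 * δ))) / b) atTop
      (𝓝 ((b ^ 2 * δ / δ + 0) + b + (0 + 8 * (b ^ 2 * δ / δ + 0)) / b)) :=
    ((tendsto_const_nhds.add (hst _ hε)).add_const b).add
      ((tendsto_one_div_atTop_nhds_zero_nat.add
        ((tendsto_const_nhds.add (hst _ hε)).const_mul 8)).div_const b)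
  have hlt : (b ^ 2 * δ / δ + 0) + b + (0 + 8 * (b ^ 2 * δ / δ + 0)) / b < e := by
    have : (b ^ 2 * δ / δ + 0) + b + (0 + 8 * (b ^ 2 * δ / δ + 0)) / b = b ^ 2 + 9 * b := by
      field_simp; ring
    rw [this]
    nlinarith
  filter_upwards [hlim.eventually_lt_const hlt, eventually_gt_atTop 0] with n hn hn0
  rw [Real.dist_eq, sub_zero, abs_of_nonneg (hnn n)]
  exact (integral_rampError_le hA hn0 hδ hε hb0).trans_lt hn

/-- Under tightness of the prediction errors and stability, a sample is typical with probability
tending to one. -/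
theorem tendsto_measureReal_not_isTypical (hA : A.IsMeasurable)
    (hst : ∀ ε : ℝ, 0 < ε → Tendsto (fun n => instability A (P n) n ε) atTop (𝓝 0))
    (htight : ∀ ε : ℝ, 0 < ε → ∃ M : ℝ, ∀ n, 2 ≤ n →
      ((Measure.pi fun _ : Fin n => P n).prod (P n)).real {q | M < |residual A q.1 q.2|} ≤ ε)
    {δ η : ℝ} (hδ : 0 < δ) (hη : 0 < η) :
    Tendsto (fun n => (Measure.pi fun _ : Fin n => P n).real {T | ¬ IsTypical A (P n) δ η T})
      atTop (𝓝 0) := by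
  rw [Metric.tendsto_nhds]
  intro e he
  have hδ' : 0 < δ / 2 := by positivity
  have hη' : 0 < η / 2 := by positivity
  obtain ⟨M, hM⟩ := htight (e / 2 * (η / 2)) (by positivity)
  obtain ⟨K, hK⟩ := exists_nat_ge ((2 * M + δ / 2 + 1) / (δ / 2))
  rw [div_le_iff₀ hδ'] at hK
  have hlim : Tendsto (fun n : ℕ => ∑ k ∈ Finset.range (K + 1),
          (∫ T, rampError A (P n) (-M - δ / 2 - 1 + k * (δ / 2)) (δ / 2) T
            ∂(Measure.pi fun _ : Fin n => P n)) / (η / 2)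
        + instability A (P n) n (δ / 2) / (η / 2) / (η / 2)) atTop
      (𝓝 (∑ k ∈ Finset.range (K + 1), 0 / (η / 2) + 0 / (η / 2) / (η / 2))) :=
    (tendsto_finsetSum _ fun k _ =>
      (tendsto_integral_rampError hA hst _ hδ').div_const _).add
      (((hst _ hδ').div_const _).div_const _)
  have h0 : ∑ k ∈ Finset.range (K + 1), 0 / (η / 2) + 0 / (η / 2) / (η / 2) < e / 2 := by
    simp; positivity
  filter_upwards [hlim.eventually_lt_const h0, eventually_ge_atTop 2] with n hn hn2
  rw [Real.dist_eq, sub_zero, abs_of_nonneg measureReal_nonneg]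
  have key := measureReal_not_isTypical_le (P := P n) (n := n) hA hδ' hη' hK
  rw [show 2 * (δ / 2) = δ by ring, show 2 * (η / 2) = η by ring] at key
  have h1 : ((Measure.pi fun _ : Fin n => P n).prod (P n)).real {q | M < |residual A q.1 q.2|}
      / (η / 2) ≤ e / 2 := by
    rw [div_le_iff₀ hη']; exact hM n hn2
  linarith

end Asymptotics

/-! ### Independent samples and the product measure -/

section Transfer

variable {Ω : Type*} [MeasurableSpace Ω] {p n : ℕ} {μ : Measure Ω}
  {P : Measure (Pair p)} {Z : Fin (n + 1) → Ω → Pair p} {A : Algorithm}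

/-- The probability that the interval computed from the fixed training data `T` covers the
response of a new pair with law `P`. -/
noncomputable def coverage (A : Algorithm) (P : Measure (Pair p)) (δ α₁ α₂ : ℝ)
    (T : Fin n → Pair p) : ℝ :=
  P.real {z | z.1 ∈ plusInterval A T δ α₁ α₂ z.2}

/-- The largest deviation of the coverage of the undistorted interval from the nominal level. -/
noncomputable def coverageError (A : Algorithm) (P : Measure (Pair p)) (T : Fin n → Pair p) : ℝ :=
  ⨆ α : Levels, |coverage A P 0 α.1.1 α.1.2 T - (α.1.2 - α.1.1)|

lemma IsIIDSample.measurable_training (hZ : IsIIDSample μ P Z) : Measurable (training Z) :=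
  measurable_pi_lambda _ fun _ => hZ.measurable _

variable [IsProbabilityMeasure μ] [IsProbabilityMeasure P]

lemma IsIIDSample.measurePreserving (hZ : IsIIDSample μ P Z) :
    MeasurePreserving (fun ω => (training Z ω, Z (Fin.last n) ω)) μ
      ((Measure.pi fun _ : Fin n => P).prod P) := by
  have h1 : MeasurePreserving (fun ω i => Z i ω) μ (Measure.pi fun _ : Fin (n + 1) => P) := by
    refine ⟨measurable_pi_lambda _ hZ.measurable, ?_⟩
    rw [(iIndepFun_iff_map_fun_eq_pi_map fun i => (hZ.measurable i).aemeasurable).1 hZ.indep]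
    simp only [hZ.law]
  have h2 := measurePreserving_piFinSuccAbove (fun _ : Fin (n + 1) => P) (Fin.last n)
  have h3 := (Measure.measurePreserving_swap (μ := P) (ν := Measure.pi fun _ : Fin n => P)).comp
    (h2.comp h1)
  convert h3 using 1
  funext ω
  refine Prod.ext ?_ rfl
  funext i
  simp [training, MeasurableEquiv.piFinSuccAbove, Fin.insertNthEquiv, Fin.init]

lemma IsIIDSample.measurePreserving_training (hZ : IsIIDSample μ P Z) :
    MeasurePreserving (training Z) μ (Measure.pi fun _ : Fin n => P) :=
  measurePreserving_fst.comp hZ.measurePreserving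

/-- Since the new pair is independent of the training data, its conditional distribution given
them is `P`. The exceptional null set does not depend on the distortion and the levels. -/
lemma IsIIDSample.condCoverage_eq (hZ : IsIIDSample μ P Z) (A : Algorithm) :
    ∀ᵐ ω ∂μ, ∀ δ α₁ α₂, condCoverage μ A Z δ α₁ α₂ ω = coverage A P δ α₁ α₂ (training Z ω) := by
  have h : condDistrib (Z (Fin.last n)) (training Z) μ =ᵐ[μ.map (training Z)]
      Kernel.const _ P := by
    refine condDistrib_ae_eq_of_measure_eq_compProd _ (hZ.measurable _).aemeasurable ?_
    rw [hZ.measurePreserving.map_eq, hZ.measurePreserving_training.map_eq, Measure.compProd_const]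
  filter_upwards [ae_of_ae_map hZ.measurable_training.aemeasurable h] with ω hω δ α₁ α₂
  rw [condCoverage, hω, Kernel.const_apply, coverage]

lemma IsIIDSample.instability_eq (hZ : IsIIDSample μ P Z) (hA : A.IsMeasurable) (ε : ℝ) :
    instability A P n ε = (1 / (n : ℝ)) * ∑ i : Fin n,
      μ.real {ω | ε ≤ |predictor A Z ω - looPredictor A Z i ω|} := by
  unfold instability
  congr 1
  refine Finset.sum_congr rfl fun i _ => ?_
  rw [measureReal_def, ← hZ.measurePreserving.measure_preimage
    (measurableSet_unstable hA i ε).nullMeasurableSet]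
  rfl

lemma IsIIDSample.measure_residual_eq (hZ : IsIIDSample μ P Z) (hA : A.IsMeasurable) (M : ℝ≥0) :
    ((Measure.pi fun _ : Fin n => P).prod P) {q | (M : ℝ) < |residual A q.1 q.2|}
      = μ {ω | (M : ℝ≥0∞) < ‖predictionError A Z ω‖ₑ} := by
  have hS : MeasurableSet {q : (Fin n → Pair p) × Pair p | (M : ℝ) < |residual A q.1 q.2|} :=
    measurableSet_lt measurable_const hA.residual.abs
  rw [← hZ.measurePreserving.measure_preimage hS.nullMeasurableSet]
  congr 1
  ext ω
  simp only [Set.mem_preimage, Set.mem_ofPred, residual, predictionError, predictor, enorm,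
    ENNReal.coe_lt_coe, ← NNReal.coe_lt_coe, coe_nnnorm, Real.norm_eq_abs]

end Transfer

/-! ### Coverage of the distorted intervals -/

section Convergence

variable {A : Algorithm} {p : ℕ → ℕ} {P : ∀ n, Measure (Pair (p n))}
  [∀ n, IsProbabilityMeasure (P n)] {Ω : ℕ → Type*} [∀ n, MeasurableSpace (Ω n)]
  {μ : ∀ n, Measure (Ω n)} [∀ n, IsProbabilityMeasure (μ n)]
  {Z : ∀ n, Fin (n + 1) → Ω n → Pair (p n)}

/-- The training data are typical with probability tending to one. The set of typical training
data need not be measurable, so that this is a statement about outer measures. -/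
theorem tendsto_measureReal_not_isTypical_training (hA : A.IsMeasurable)
    (hZ : ∀ n, 2 ≤ n → IsIIDSample (μ n) (P n) (Z n))
    (hbounded : StochBounded μ (fun n ω => ‖predictionError A (Z n) ω‖ₑ))
    (hstable : Stable μ A Z) {δ η : ℝ} (hδ : 0 < δ) (hη : 0 < η) :
    Tendsto (fun n => (μ n).real {ω | ¬ IsTypical A (P n) δ η (training (Z n) ω)}) atTop (𝓝 0) := by
  have h := tendsto_measureReal_not_isTypical (P := P) hA (fun ε hε => ?_) (fun ε hε => ?_) hδ hη
  · refine tendsto_of_tendsto_of_tendsto_of_le_of_le' tendsto_const_nhds h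
      (Eventually.of_forall fun n => measureReal_nonneg) ?_
    filter_upwards [eventually_ge_atTop 2] with n hn
    rw [← (hZ n hn).measurePreserving_training.map_eq]
    refine ENNReal.toReal_mono (measure_ne_top _ _) ?_
    exact Measure.le_map_apply (hZ n hn).measurable_training.aemeasurable
      {T | ¬ IsTypical A (P n) δ η T}
  · refine (hstable ε hε).congr' ?_
    filter_upwards [eventually_ge_atTop 2] with n hn
    exact ((hZ n hn).instability_eq hA ε).symm
  · obtain ⟨M, hM⟩ := hbounded (ENNReal.ofReal ε) (ENNReal.ofReal_pos.2 hε)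
    refine ⟨M, fun n hn => ?_⟩
    refine ENNReal.toReal_le_of_le_ofReal hε.le ?_
    rw [(hZ n hn).measure_residual_eq hA]
    exact hM n hn

lemma tendsto_measureReal_one_of_compl {S : ∀ n, Set (Ω n)} {b : ℕ → ℝ}
    (hb : Tendsto b atTop (𝓝 0)) (hS : ∀ᶠ n in atTop, (μ n).real (S n)ᶜ ≤ b n) :
    Tendsto (fun n => (μ n).real (S n)) atTop (𝓝 1) := by
  have h1 : Tendsto (fun n => 1 - b n) atTop (𝓝 1) := by simpa using hb.const_sub 1
  refine tendsto_of_tendsto_of_tendsto_of_le_of_le' h1 tendsto_const_nhds ?_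
    (Eventually.of_forall fun n => measureReal_le_one)
  filter_upwards [hS] with n hn
  have : (μ n).real Set.univ ≤ (μ n).real (S n) + (μ n).real (S n)ᶜ := by
    rw [← Set.union_compl_self (S n)]; exact measureReal_union_le _ _
  rw [probReal_univ] at this
  linarith

/-- An event which, for almost every outcome with typical training data, takes place has
probability tending to one. -/
lemma tendsto_measureReal_one_of_isTypical (hA : A.IsMeasurable)
    (hZ : ∀ n, 2 ≤ n → IsIIDSample (μ n) (P n) (Z n))
    (hbounded : StochBounded μ (fun n ω => ‖predictionError A (Z n) ω‖ₑ))
    (hstable : Stable μ A Z) {δ η : ℝ} (hδ : 0 < δ) (hη : 0 < η) {S : ∀ n, Set (Ω n)}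
    (hS : ∀ n, 2 ≤ n → ∀ᵐ ω ∂(μ n), IsTypical A (P n) δ η (training (Z n) ω) → ω ∈ S n) :
    Tendsto (fun n => (μ n).real (S n)) atTop (𝓝 1) := by
  refine tendsto_measureReal_one_of_compl
    (tendsto_measureReal_not_isTypical_training hA hZ hbounded hstable hδ hη) ?_
  filter_upwards [eventually_ge_atTop 2] with n hn
  refine ENNReal.toReal_mono (measure_ne_top _ _) (measure_mono_ae ?_)
  filter_upwards [hS n hn] with ω hω h h'
  exact h (hω h')

instance : Nonempty Levels := ⟨⟨(0, 0), by norm_num⟩⟩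

theorem tendsto_measureReal_le_iInf_coverage (hA : A.IsMeasurable)
    (hZ : ∀ n, 2 ≤ n → IsIIDSample (μ n) (P n) (Z n))
    (hbounded : StochBounded μ (fun n ω => ‖predictionError A (Z n) ω‖ₑ))
    (hstable : Stable μ A Z) {δ ε : ℝ} (hδ : 0 < δ) (hε : 0 < ε) :
    Tendsto (fun n : ℕ => (μ n).real {ω | -ε ≤ ⨅ α : Levels,
      (condCoverage (μ n) A (Z n) δ α.1.1 α.1.2 ω - (α.1.2 - α.1.1))}) atTop (𝓝 1) := by
  refine tendsto_measureReal_one_of_isTypical hA hZ hbounded hstable (δ := δ / 4) (η := ε / 5)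
    (by positivity) (by positivity) fun n hn => ?_
  filter_upwards [(hZ n hn).condCoverage_eq A] with ω hω hT
  refine le_ciInf fun α => ?_
  have := hT.le_coverage (by omega) (by positivity) (by positivity) α.2.1 α.2.2.2
  rw [hω, coverage]
  rw [show 4 * (δ / 4) = δ by ring] at this
  linarith

theorem tendsto_measureReal_iSup_coverage_le (hA : A.IsMeasurable)
    (hZ : ∀ n, 2 ≤ n → IsIIDSample (μ n) (P n) (Z n))
    (hbounded : StochBounded μ (fun n ω => ‖predictionError A (Z n) ω‖ₑ))
    (hstable : Stable μ A Z) {δ ε : ℝ} (hδ : 0 < δ) (hε : 0 < ε) :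
    Tendsto (fun n : ℕ => (μ n).real {ω | (⨆ α : Levels,
      (condCoverage (μ n) A (Z n) (-δ) α.1.1 α.1.2 ω - (α.1.2 - α.1.1))) ≤ ε}) atTop (𝓝 1) := by
  refine tendsto_measureReal_one_of_isTypical hA hZ hbounded hstable (δ := δ / 4) (η := ε / 5)
    (by positivity) (by positivity) fun n hn => ?_
  filter_upwards [(hZ n hn).condCoverage_eq A] with ω hω hT
  refine ciSup_le fun α => ?_
  have := hT.coverage_le hA (by omega) (by positivity) (by positivity) α.2.1 α.2.2.1 α.2.2.2
  rw [hω, coverage]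
  rw [show 4 * (δ / 4) = δ by ring] at this
  linarith

end Convergence

/-! ### Measurability of the coverage error -/

section Measurability

variable {p n : ℕ} {A : Algorithm}

lemma Algorithm.IsMeasurable.plusPoint (hA : A.IsMeasurable) (i : Fin n) :
    Measurable fun q : (Fin n → Pair p) × Pair p => plusPoint A q.1 q.2.2 i := by
  have : Measurable fun q : (Fin n → Pair p) × Pair p => (q.1, q.1 i) := by fun_prop
  exact (hA.looPredict i).add ((by fun_prop :
    Measurable fun q : (Fin n → Pair p) × Pair p => (q.1 i).1).sub ((hA.looPredict i).comp this))

lemma measurable_average_indicator {β : Type*} [MeasurableSpace β] {S : Fin n → Set β}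
    (hS : ∀ i, MeasurableSet (S i)) :
    Measurable fun x => (1 / (n : ℝ)) * ∑ i, (S i).indicator (fun _ => (1 : ℝ)) x :=
  (Finset.measurable_sum _ fun i _ => measurable_const.indicator (hS i)).const_mul _

lemma Algorithm.IsMeasurable.ecdf_plusPoint (hA : A.IsMeasurable) (c : ℝ) :
    Measurable fun q : (Fin n → Pair p) × Pair p =>
      ecdf (JackknifePlus.plusPoint A q.1 q.2.2) (q.2.1 + c) :=
  measurable_average_indicator fun i => measurableSet_le (hA.plusPoint i)
    (by fun_prop : Measurable fun q : (Fin n → Pair p) × Pair p => q.2.1 + c)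

lemma Algorithm.IsMeasurable.ecdfLeft_plusPoint (hA : A.IsMeasurable) (c : ℝ) :
    Measurable fun q : (Fin n → Pair p) × Pair p =>
      ecdfLeft (JackknifePlus.plusPoint A q.1 q.2.2) (q.2.1 - c) :=
  measurable_average_indicator fun i => measurableSet_lt (hA.plusPoint i)
    (by fun_prop : Measurable fun q : (Fin n → Pair p) × Pair p => q.2.1 - c)

lemma measurable_ecdf_plusPoint_right (hA : A.IsMeasurable) (T : Fin n → Pair p) (c : ℝ) :
    Measurable fun z : Pair p => ecdf (plusPoint A T z.2) (z.1 + c) := by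
  simpa only [Function.comp_def] using (hA.ecdf_plusPoint c).comp (measurable_prodMk_left (x := T))

lemma measurable_ecdfLeft_plusPoint_right (hA : A.IsMeasurable) (T : Fin n → Pair p) (c : ℝ) :
    Measurable fun z : Pair p => ecdfLeft (plusPoint A T z.2) (z.1 - c) := by
  simpa only [Function.comp_def] using
    (hA.ecdfLeft_plusPoint c).comp (measurable_prodMk_left (x := T))

lemma measurable_coverage (hA : A.IsMeasurable) (P : Measure (Pair p)) [IsProbabilityMeasure P]
    (δ α₁ α₂ : ℝ) : Measurable (coverage A P δ α₁ α₂ : (Fin n → Pair p) → ℝ) := by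
  have hS : MeasurableSet {q : (Fin n → Pair p) × Pair p |
      q.2.1 ∈ plusInterval A q.1 δ α₁ α₂ q.2.2} := by
    simp only [mem_plusInterval_iff]
    exact (measurableSet_le measurable_const (hA.ecdf_plusPoint δ)).inter
      (measurableSet_lt (hA.ecdfLeft_plusPoint δ) measurable_const)
  exact measurable_measureReal_prodMk P hS

lemma exists_average_indicator_eq (S : Fin n → Prop) [DecidablePred S] :
    ∃ m : ℕ, (1 / (n : ℝ)) * ∑ i, (if S i then (1 : ℝ) else 0) = m / n := by
  refine ⟨(Finset.univ.filter S).card, ?_⟩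
  rw [Finset.sum_boole]
  ring

lemma exists_ecdf_eq (v : Fin n → ℝ) (t : ℝ) : ∃ m : ℕ, ecdf v t = m / n := by
  classical
  exact exists_average_indicator_eq fun i => v i ∈ Set.Iic t

lemma exists_ecdfLeft_eq (v : Fin n → ℝ) (t : ℝ) : ∃ m : ℕ, ecdfLeft v t = m / n := by
  classical
  exact exists_average_indicator_eq fun i => v i ∈ Set.Iio t

/-- Below a level there are arbitrarily close rational levels which are not separated from it by
a possible value of an empirical distribution function of `n` points. -/
lemma exists_rat_level (hn : 0 < n) {α e : ℝ} (hα : 0 ≤ α) (he : 0 < e) :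
    ∃ q : ℚ, 0 ≤ (q : ℝ) ∧ (q : ℝ) ≤ α ∧ α - e < q ∧
      ∀ m : ℕ, (q : ℝ) ≤ m / n ↔ α ≤ m / n := by
  have hn' : (0 : ℝ) < n := by exact_mod_cast hn
  rcases hα.eq_or_lt with rfl | hα
  · refine ⟨0, by simp, by simp, by simpa using he, fun m => by simp⟩
  set k := ⌈n * α⌉₊
  have hk1 : ((k : ℝ) - 1) / n < α := by
    rw [div_lt_iff₀ hn']
    have := Nat.ceil_lt_add_one (show 0 ≤ n * α by positivity)
    linarith
  have hk2 : α ≤ k / n := by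
    rw [le_div_iff₀ hn', mul_comm]
    exact Nat.le_ceil _
  obtain ⟨q, hq1, hq2⟩ := exists_rat_btwn
    (show max (max 0 (α - e)) (((k : ℝ) - 1) / n) < α from
      max_lt (max_lt hα (by linarith)) hk1)
  have h1 := (le_max_left _ _).trans_lt hq1
  refine ⟨q, ((le_max_left _ _).trans_lt h1).le, hq2.le, (le_max_right _ _).trans_lt h1,
    fun m => ⟨fun hm => ?_, fun hm => hq2.le.trans hm⟩⟩
  have h2 := ((le_max_right _ _).trans_lt hq1).trans_le hm
  rw [div_lt_div_iff_of_pos_right hn'] at h2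
  have h3 : k < m + 1 := by
    have : (k : ℝ) < m + 1 := by linarith
    exact_mod_cast this
  have h4 : (k : ℝ) ≤ m := by exact_mod_cast Nat.lt_succ_iff.1 h3
  exact hk2.trans (div_le_div_of_nonneg_right h4 hn'.le)

/-- The pairs of rational nominal levels. -/
abbrev RatLevels : Type := {q : ℚ × ℚ // 0 ≤ q.1 ∧ q.1 ≤ q.2 ∧ q.2 ≤ 1}

instance : Nonempty RatLevels := ⟨⟨(0, 0), by norm_num⟩⟩

/-- A rational pair of levels as a pair of levels. -/
def RatLevels.toLevels (q : RatLevels) : Levels :=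
  ⟨((q.1.1 : ℝ), (q.1.2 : ℝ)), Rat.cast_nonneg.2 q.2.1, Rat.cast_le.2 q.2.2.1,
    (Rat.cast_le.2 q.2.2.2).trans_eq Rat.cast_one⟩

lemma abs_coverage_sub_le_one (A : Algorithm) (P : Measure (Pair p)) [IsProbabilityMeasure P]
    (T : Fin n → Pair p) (δ : ℝ) (α : Levels) :
    |coverage A P δ α.1.1 α.1.2 T - (α.1.2 - α.1.1)| ≤ 1 :=
  abs_sub_le_one_of_mem_Icc ⟨measureReal_nonneg, measureReal_le_one⟩
    ⟨by linarith [α.2.2.1], by linarith [α.2.1, α.2.2.2]⟩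

/-- The supremum over all levels equals that over the rational levels: within a range of levels
that give the same interval, the deviation is continuous in the levels. -/
lemma coverageError_eq_iSup_rat (A : Algorithm) (P : Measure (Pair p)) [IsProbabilityMeasure P]
    (hn : 0 < n) (T : Fin n → Pair p) :
    coverageError A P T = ⨆ q : RatLevels,
      |coverage A P 0 q.toLevels.1.1 q.toLevels.1.2 T
        - (q.toLevels.1.2 - q.toLevels.1.1)| := by
  have hb : BddAbove (Set.range fun α : Levels =>
      |coverage A P 0 α.1.1 α.1.2 T - (α.1.2 - α.1.1)|) :=
    ⟨1, by rintro _ ⟨α, rfl⟩; exact abs_coverage_sub_le_one A P T 0 α⟩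
  have hb' : BddAbove (Set.range fun q : RatLevels =>
      |coverage A P 0 q.toLevels.1.1 q.toLevels.1.2 T - (q.toLevels.1.2 - q.toLevels.1.1)|) :=
    ⟨1, by rintro _ ⟨q, rfl⟩; exact abs_coverage_sub_le_one A P T 0 _⟩
  refine le_antisymm (ciSup_le ?_) (ciSup_le fun q => le_ciSup hb q.toLevels)
  rintro ⟨⟨α₁, α₂⟩, h0, h12, h1⟩
  refine le_of_forall_pos_le_add fun e he => ?_
  simp only at h0 h12 h1 ⊢
  obtain ⟨q₁, a1, a2, a3, a4⟩ := exists_rat_level hn h0 he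
  obtain ⟨q₂, b1, b2, b3, b4, b5⟩ : ∃ q : ℚ, (q₁ : ℝ) ≤ q ∧ (q : ℝ) ≤ α₂ ∧ α₂ - e < q ∧
      (∀ m : ℕ, (q : ℝ) ≤ m / n ↔ α₂ ≤ m / n) ∧ (q : ℝ) ≤ 1 := by
    rcases h12.eq_or_lt with rfl | hlt
    · exact ⟨q₁, le_rfl, a2, a3, a4, a2.trans h1⟩
    · obtain ⟨q, c1, c2, c3, c4⟩ := exists_rat_level hn (h0.trans h12)
        (lt_min he (sub_pos.2 hlt))
      have m1 := min_le_left e (α₂ - α₁)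
      have m2 := min_le_right e (α₂ - α₁)
      exact ⟨q, by linarith, c2, by linarith, c4, c2.trans h1⟩
  let q : RatLevels := ⟨(q₁, q₂), by exact_mod_cast a1, by exact_mod_cast b1, by exact_mod_cast b5⟩
  have hcov : coverage A P 0 α₁ α₂ T = coverage A P 0 q₁ q₂ T := by
    unfold coverage
    congr 1
    ext z
    simp only [Set.mem_ofPred, mem_plusInterval_iff]
    obtain ⟨m, hm⟩ := exists_ecdf_eq (plusPoint A T z.2) (z.1 + 0)
    obtain ⟨m', hm'⟩ := exists_ecdfLeft_eq (plusPoint A T z.2) (z.1 - 0)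
    rw [hm, hm', a4, ← not_le, ← not_le, b4]
  have := le_ciSup hb' q
  refine le_trans ?_ (add_le_add_left this e)
  simp only [q, RatLevels.toLevels]
  rw [hcov]
  have e1 : |(q₂ - q₁ : ℝ) - (α₂ - α₁)| ≤ e := abs_le.2 ⟨by linarith, by linarith⟩
  have e2 := abs_sub_le (coverage A P 0 q₁ q₂ T) (q₂ - q₁) (α₂ - α₁)
  linarith

lemma measurable_coverageError (hA : A.IsMeasurable) (P : Measure (Pair p))
    [IsProbabilityMeasure P] (hn : 0 < n) :
    Measurable (coverageError A P : (Fin n → Pair p) → ℝ) := by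
  have : (coverageError A P : (Fin n → Pair p) → ℝ) = fun T => ⨆ q : RatLevels,
      |coverage A P 0 q.toLevels.1.1 q.toLevels.1.2 T - (q.toLevels.1.2 - q.toLevels.1.1)| :=
    funext fun T => coverageError_eq_iSup_rat A P hn T
  rw [this]
  exact Measurable.iSup fun q => ((measurable_coverage hA P _ _ _).sub_const _).abs

lemma coverageError_mem_Icc (A : Algorithm) (P : Measure (Pair p)) [IsProbabilityMeasure P]
    (T : Fin n → Pair p) : coverageError A P T ∈ Set.Icc (0 : ℝ) 1 :=
  ⟨Real.iSup_nonneg fun _ => abs_nonneg _, ciSup_le fun α => abs_coverage_sub_le_one A P T 0 α⟩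

end Measurability

/-! ### Bounded conditional densities -/

section Density

variable {p n : ℕ} {P : Measure (Pair p)} [IsProbabilityMeasure P]

lemma measure_le_essSup_rnDeriv_mul {ν : Measure ℝ} [IsFiniteMeasure ν] (h : ν ≪ volume)
    (s : Set ℝ) : ν s ≤ essSup (ν.rnDeriv volume) volume * volume s := by
  calc ν s ≤ ν (toMeasurable volume s) := measure_mono (subset_toMeasurable _ _)
    _ = ∫⁻ y in toMeasurable volume s, ν.rnDeriv volume y := by
        conv_lhs => rw [← Measure.withDensity_rnDeriv_eq ν volume h]
        exact withDensity_apply _ (measurableSet_toMeasurable _ _)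
    _ ≤ ∫⁻ _ in toMeasurable volume s, essSup (ν.rnDeriv volume) volume :=
        lintegral_mono_ae (ae_restrict_of_ae (ENNReal.ae_le_essSup _))
    _ = _ := by rw [setLIntegral_const, measure_toMeasurable]

/-- A set whose sections in the direction of the response have diameter at most `L` has small
probability if the conditional density of the response is bounded with high probability. -/
lemma measureReal_le_of_section (hac : ∀ᵐ x ∂P.map Prod.snd, condResponse P x ≪ volume)
    {M : ℝ≥0} {ε L : ℝ} (hε : 0 ≤ ε) (hL : 0 ≤ L)
    (hM : P.map Prod.snd {x | (M : ℝ≥0∞) < condDensitySup P x} ≤ ENNReal.ofReal ε)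
    {S : Set (Pair p)} (hS : MeasurableSet S)
    (hsec : ∀ x y y', (y, x) ∈ S → (y', x) ∈ S → y - y' ≤ L) :
    P.real S ≤ 2 * L * M + ε := by
  refine ENNReal.toReal_le_of_le_ofReal (by positivity) ?_
  have hsw : Measurable (Prod.swap : (Fin p → ℝ) × ℝ → Pair p) := measurable_swap
  have e : P.map Prod.snd ⊗ₘ condResponse P = P.map Prod.swap :=
    compProd_map_condDistrib measurable_fst.aemeasurable
  have e1 : P S = ∫⁻ x, condResponse P x (Prod.mk x ⁻¹' (Prod.swap ⁻¹' S)) ∂P.map Prod.snd := by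
    have : IsMarkovKernel (condResponse P) := by unfold condResponse; infer_instance
    rw [← Measure.compProd_apply (hsw hS), e, Measure.map_apply measurable_swap (hsw hS)]
    rfl
  set B := toMeasurable (P.map Prod.snd) {x | (M : ℝ≥0∞) < condDensitySup P x}
  have hB : MeasurableSet B := measurableSet_toMeasurable _ _
  rw [e1]
  calc _ ≤ ∫⁻ x, (ENNReal.ofReal (2 * L * M) + B.indicator 1 x) ∂P.map Prod.snd := by
        refine lintegral_mono_ae ?_
        filter_upwards [hac] with x hx
        have : IsMarkovKernel (condResponse P) := by unfold condResponse; infer_instance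
        by_cases hxB : x ∈ B
        · rw [Set.indicator_of_mem hxB]
          exact prob_le_one.trans le_add_self
        refine le_trans ?_ le_self_add
        rcases Set.eq_empty_or_nonempty (Prod.mk x ⁻¹' (Prod.swap ⁻¹' S)) with h0 | ⟨y₀, hy₀⟩
        · rw [h0]; simp
        have hsub : Prod.mk x ⁻¹' (Prod.swap ⁻¹' S) ⊆ Set.Icc (y₀ - L) (y₀ + L) := by
          intro y hy
          have h1 := hsec x y y₀ hy hy₀
          have h2 := hsec x y₀ y hy₀ hy
          exact ⟨by linarith, by linarith⟩
        have hMx : condDensitySup P x ≤ M :=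
          not_lt.1 fun h => hxB (subset_toMeasurable _ _ h)
        calc _ ≤ condResponse P x (Set.Icc (y₀ - L) (y₀ + L)) := measure_mono hsub
          _ ≤ condDensitySup P x * volume (Set.Icc (y₀ - L) (y₀ + L)) :=
              measure_le_essSup_rnDeriv_mul hx _
          _ ≤ M * ENNReal.ofReal (2 * L) := by
              rw [Real.volume_Icc, show y₀ + L - (y₀ - L) = 2 * L by ring]
              gcongr
          _ = ENNReal.ofReal (2 * L * M) := by
              rw [ENNReal.ofReal_mul (p := 2 * L) (by positivity), ENNReal.ofReal_coe_nnreal,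
                mul_comm]
    _ = ENNReal.ofReal (2 * L * M) + P.map Prod.snd B := by
        have : IsProbabilityMeasure (P.map Prod.snd) :=
          Measure.isProbabilityMeasure_map measurable_snd.aemeasurable
        rw [lintegral_add_left measurable_const, lintegral_indicator_one hB]
        simp
    _ ≤ ENNReal.ofReal (2 * L * M) + ENNReal.ofReal ε := by
        rw [measure_toMeasurable]; gcongr
    _ = ENNReal.ofReal (2 * L * M + ε) := (ENNReal.ofReal_add (by positivity) hε).symm

variable {A : Algorithm}

lemma coverage_mono (A : Algorithm) (P : Measure (Pair p)) [IsProbabilityMeasure P] {δ δ' : ℝ}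
    (h : δ ≤ δ') (α₁ α₂ : ℝ) (T : Fin n → Pair p) :
    coverage A P δ α₁ α₂ T ≤ coverage A P δ' α₁ α₂ T := by
  refine measureReal_mono fun z hz => ?_
  simp only [Set.mem_ofPred, mem_plusInterval_iff] at hz ⊢
  refine ⟨hz.1.trans (ecdf_mono _ (by linarith)), lt_of_le_of_lt ?_ hz.2⟩
  exact average_mono fun i => indicator_one_le_indicator_one fun hx =>
    Set.mem_Iio.2 ((Set.mem_Iio.1 hx).trans_le (by linarith))

/-- Enlarging and shrinking the interval changes its coverage little if the conditional density
of the response is bounded with high probability: the two intervals differ by neighbourhoods of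
the end points. -/
lemma coverage_le_coverage_neg_add (hA : A.IsMeasurable)
    (hac : ∀ᵐ x ∂P.map Prod.snd, condResponse P x ≪ volume) {M : ℝ≥0} {ε δ : ℝ} (hε : 0 ≤ ε)
    (hδ : 0 ≤ δ) (hM : P.map Prod.snd {x | (M : ℝ≥0∞) < condDensitySup P x} ≤ ENNReal.ofReal ε)
    (α₁ α₂ : ℝ) (T : Fin n → Pair p) :
    coverage A P δ α₁ α₂ T ≤ coverage A P (-δ) α₁ α₂ T + 2 * (4 * δ * M + ε) := by
  let F : ℝ → Pair p → ℝ := fun c z => ecdf (plusPoint A T z.2) (z.1 + c)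
  let Fl : ℝ → Pair p → ℝ := fun c z => ecdfLeft (plusPoint A T z.2) (z.1 - c)
  have hF : ∀ c, Measurable (F c) := fun c =>
    measurable_ecdf_plusPoint_right hA T c
  have hFl : ∀ c, Measurable (Fl c) := fun c =>
    measurable_ecdfLeft_plusPoint_right hA T c
  have m1 : MeasurableSet {z | α₁ ≤ F δ z ∧ F (-δ) z < α₁} :=
    (measurableSet_le measurable_const (hF δ)).inter (measurableSet_lt (hF (-δ)) measurable_const)
  have m2 : MeasurableSet {z | Fl δ z < α₂ ∧ α₂ ≤ Fl (-δ) z} :=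
    (measurableSet_lt (hFl δ) measurable_const).inter (measurableSet_le measurable_const (hFl (-δ)))
  -- two responses near the same end point at the same features differ by at most `2 * δ`
  have b1 : P.real {z | α₁ ≤ F δ z ∧ F (-δ) z < α₁} ≤ 2 * (2 * δ) * M + ε := by
    refine measureReal_le_of_section hac hε (by positivity) hM m1 ?_
    rintro x y y' ⟨-, h1⟩ ⟨h2, -⟩
    by_contra! hlt
    have : F δ (y', x) ≤ F (-δ) (y, x) := ecdf_mono (plusPoint A T x)
      (show y' + δ ≤ y + -δ by linarith)
    linarith
  have b2 : P.real {z | Fl δ z < α₂ ∧ α₂ ≤ Fl (-δ) z} ≤ 2 * (2 * δ) * M + ε := by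
    refine measureReal_le_of_section hac hε (by positivity) hM m2 ?_
    rintro x y y' ⟨h1, -⟩ ⟨-, h2⟩
    by_contra! hlt
    have : Fl (-δ) (y', x) ≤ Fl δ (y, x) := 
      (ecdfLeft_le_ecdf (plusPoint A T x) (y' - -δ)).trans
        (ecdf_le_ecdfLeft (plusPoint A T x) (show y' - -δ < y - δ by linarith))
    exact absurd (h2.trans_lt (this.trans_lt h1)) (lt_irrefl _)
  have hsub : {z | z.1 ∈ plusInterval A T δ α₁ α₂ z.2} ⊆
      {z | z.1 ∈ plusInterval A T (-δ) α₁ α₂ z.2}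
        ∪ {z | α₁ ≤ F δ z ∧ F (-δ) z < α₁} ∪ {z | Fl δ z < α₂ ∧ α₂ ≤ Fl (-δ) z} := by
    intro z hz
    simp only [Set.mem_union, Set.mem_ofPred, mem_plusInterval_iff] at hz ⊢
    by_contra! hcon
    exact absurd (hcon.2 hz.2)
      (not_lt.2 (le_of_not_gt fun h => absurd (hcon.1.2 hz.1)
        (not_le.2 (lt_of_not_ge fun h' => absurd (hcon.1.1 h') (not_le.2 h)))))
  have h := (measureReal_mono (μ := P) hsub).trans (measureReal_union_le _ _)
  have h := h.trans (add_le_add_left (measureReal_union_le _ _) _)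
  unfold coverage
  linarith

/-- The undistorted interval lies between the shrunk and the enlarged one. -/
lemma IsTypical.coverageError_le (hA : A.IsMeasurable) (hn : 0 < n)
    (hac : ∀ᵐ x ∂P.map Prod.snd, condResponse P x ≪ volume) {M : ℝ≥0} {ε δ η : ℝ} (hε : 0 ≤ ε)
    (hδ : 0 < δ) (hη : 0 ≤ η)
    (hM : P.map Prod.snd {x | (M : ℝ≥0∞) < condDensitySup P x} ≤ ENNReal.ofReal ε)
    {T : Fin n → Pair p} (hT : IsTypical A P (δ / 4) η T) :
    coverageError A P T ≤ 5 * η + 2 * (4 * δ * M + ε) := by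
  refine ciSup_le fun α => ?_
  have h1 := hT.le_coverage hn (by positivity) hη α.2.1 α.2.2.2
  have h2 := hT.coverage_le hA hn (by positivity) hη α.2.1 α.2.2.1 α.2.2.2
  rw [show 4 * (δ / 4) = δ by ring] at h1 h2
  have h3 := coverage_le_coverage_neg_add hA hac hε hδ.le hM α.1.1 α.1.2 T
  have h4 := coverage_mono A P (show -δ ≤ 0 by linarith) α.1.1 α.1.2 T
  have h5 := coverage_mono A P hδ.le α.1.1 α.1.2 T
  simp only [coverage] at h3 h4 h5 ⊢
  exact abs_le.2 ⟨by linarith, by linarith⟩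

end Density

/-! ### Convergence of the coverage error -/

section Convergence

variable {A : Algorithm} {p : ℕ → ℕ} {P : ∀ n, Measure (Pair (p n))}
  [∀ n, IsProbabilityMeasure (P n)] {Ω : ℕ → Type*} [∀ n, MeasurableSpace (Ω n)]
  {μ : ∀ n, Measure (Ω n)} [∀ n, IsProbabilityMeasure (μ n)]
  {Z : ∀ n, Fin (n + 1) → Ω n → Pair (p n)}

lemma IsIIDSample.iSup_condCoverage_ae_eq {Ω : Type*} [MeasurableSpace Ω] {p n : ℕ}
    {μ : Measure Ω} [IsProbabilityMeasure μ] {P : Measure (Pair p)} [IsProbabilityMeasure P]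
    {Z : Fin (n + 1) → Ω → Pair p} (hZ : IsIIDSample μ P Z) (A : Algorithm) :
    (fun ω => ⨆ α : Levels, |condCoverage μ A Z 0 α.1.1 α.1.2 ω - (α.1.2 - α.1.1)|)
      =ᵐ[μ] fun ω => coverageError A P (training Z ω) := by
  filter_upwards [hZ.condCoverage_eq A] with ω hω
  simp only [hω, coverageError]

lemma IsIIDSample.integrable_coverageError {Ω : Type*} [MeasurableSpace Ω] {p n : ℕ}
    {μ : Measure Ω} [IsProbabilityMeasure μ] {P : Measure (Pair p)} [IsProbabilityMeasure P]
    {Z : Fin (n + 1) → Ω → Pair p} (hZ : IsIIDSample μ P Z) (hA : A.IsMeasurable) (hn : 0 < n) :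
    Integrable (fun ω => coverageError A P (training Z ω)) μ :=
  integrable_of_abs_le ((measurable_coverageError hA P hn).comp hZ.measurable_training) (C := 1)
    fun ω => by
      have h := coverageError_mem_Icc A P (training Z ω)
      exact (abs_of_nonneg h.1).trans_le h.2

theorem tendsto_integral_coverageError (hA : A.IsMeasurable)
    (hZ : ∀ n, 2 ≤ n → IsIIDSample (μ n) (P n) (Z n))
    (hbounded : StochBounded μ (fun n ω => ‖predictionError A (Z n) ω‖ₑ))
    (hstable : Stable μ A Z) (hcc : ContinuousCase P) :
    Tendsto (fun n : ℕ => ∫ ω, coverageError A (P n) (training (Z n) ω) ∂(μ n)) atTop (𝓝 0) := by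
  have hnn : ∀ n, 0 ≤ ∫ ω, coverageError A (P n) (training (Z n) ω) ∂(μ n) := fun n =>
    integral_nonneg fun ω => (coverageError_mem_Icc A (P n) _).1
  rw [Metric.tendsto_nhds]
  intro e he
  obtain ⟨M, hM⟩ := hcc.stochBounded (ENNReal.ofReal (e / 16))
    (ENNReal.ofReal_pos.2 (by positivity))
  -- with these constants the bound for the error on typical training data is below `e / 2`
  obtain ⟨δ, hδ, hδM⟩ : ∃ δ : ℝ, 0 < δ ∧ 8 * δ * M ≤ e / 4 := by
    refine ⟨e / (32 * (M + 1)), by positivity, ?_⟩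
    have hM0 : (0 : ℝ) < M + 1 := by positivity
    have : 8 * (e / (32 * (M + 1))) * (M : ℝ) = e / 4 * (M / (M + 1)) := by field_simp; ring
    rw [this]
    exact mul_le_of_le_one_right (by positivity) ((div_le_one hM0).2 (by linarith))
  have hlim := tendsto_measureReal_not_isTypical_training hA hZ hbounded hstable
    (show 0 < δ / 4 by positivity) (show 0 < e / 80 by positivity)
  filter_upwards [hlim.eventually_lt_const (show 0 < e / 2 by positivity), eventually_ge_atTop 2]
    with n hn hn2
  rw [Real.dist_eq, sub_zero, abs_of_nonneg (hnn n)]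
  have hn0 : 0 < n := by omega
  set h : Ω n → ℝ := fun ω => coverageError A (P n) (training (Z n) ω)
  have hmeas : Measurable h :=
    (measurable_coverageError hA (P n) hn0).comp (hZ n hn2).measurable_training
  have hS : MeasurableSet {ω | e / 2 < h ω} := measurableSet_lt measurable_const hmeas
  have hi : Integrable ({ω | e / 2 < h ω}.indicator fun _ => (1 : ℝ)) (μ n) :=
    (integrable_const _).indicator hS
  have hle : (μ n).real {ω | e / 2 < h ω}
      ≤ (μ n).real {ω | ¬ IsTypical A (P n) (δ / 4) (e / 80) (training (Z n) ω)} := by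
    refine measureReal_mono fun ω hω hT => ?_
    have := hT.coverageError_le hA hn0 ((hcc.bounded_density n hn2).mono fun x hx => hx.1)
      (by positivity) hδ (by positivity) (hM n hn2)
    have hω : e / 2 < h ω := hω
    linarith
  calc ∫ ω, h ω ∂(μ n)
      ≤ ∫ ω, (e / 2 + {ω | e / 2 < h ω}.indicator (fun _ => (1 : ℝ)) ω) ∂(μ n) := by
        refine integral_mono ((hZ n hn2).integrable_coverageError hA hn0)
          ((integrable_const _).add hi) fun ω => ?_
        by_cases hω : e / 2 < h ω
        · have h1 := (coverageError_mem_Icc A (P n) (training (Z n) ω)).2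
          simp only [Set.indicator_of_mem (s := {ω | e / 2 < h ω}) hω]
          linarith
        · simp only [Set.indicator_of_notMem (s := {ω | e / 2 < h ω}) hω, add_zero]
          exact not_lt.1 hω
    _ = e / 2 + (μ n).real {ω | e / 2 < h ω} := by
        rw [integral_add (integrable_const _) hi]
        congr 1
        · simp
        · exact integral_indicator_one hS
    _ < e := by linarith

end Convergence

end JackknifePlus

theorem mainTheorem3
    (A : Algorithm) (hA : A.IsMeasurable)
    (p : ℕ → ℕ)
    (P : ∀ n, Measure (Pair (p n))) [∀ n, IsProbabilityMeasure (P n)]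
    (Ω : ℕ → Type*) [∀ n, MeasurableSpace (Ω n)]
    (μ : ∀ n, Measure (Ω n)) [∀ n, IsProbabilityMeasure (μ n)]
    (Z : ∀ n, Fin (n + 1) → Ω n → Pair (p n))
    (hZ : ∀ n, 2 ≤ n → IsIIDSample (μ n) (P n) (Z n))
    (hbounded : StochBounded μ (fun n ω => ‖predictionError A (Z n) ω‖ₑ))
    (hstable : Stable μ A Z) :
    (∀ δ : ℝ, 0 < δ →
      (∀ ε : ℝ, 0 < ε →
        Tendsto (fun n : ℕ => (μ n).real {ω | -ε ≤ ⨅ α : Levels,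
          (condCoverage (μ n) A (Z n) δ α.1.1 α.1.2 ω - (α.1.2 - α.1.1))}) atTop (𝓝 1)) ∧
      (∀ ε : ℝ, 0 < ε →
        Tendsto (fun n : ℕ => (μ n).real {ω | (⨆ α : Levels,
          (condCoverage (μ n) A (Z n) (-δ) α.1.1 α.1.2 ω - (α.1.2 - α.1.1))) ≤ ε})
          atTop (𝓝 1))) ∧
    (ContinuousCase P →
      (∀ n : ℕ, 2 ≤ n → Integrable (fun ω => ⨆ α : Levels,
        |condCoverage (μ n) A (Z n) 0 α.1.1 α.1.2 ω - (α.1.2 - α.1.1)|) (μ n)) ∧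
      Tendsto (fun n : ℕ => ∫ ω, (⨆ α : Levels,
        |condCoverage (μ n) A (Z n) 0 α.1.1 α.1.2 ω - (α.1.2 - α.1.1)|) ∂(μ n))
        atTop (𝓝 0)) := by
  refine ⟨fun δ hδ => ⟨fun ε hε => ?_, fun ε hε => ?_⟩, fun hcc => ⟨fun n hn => ?_, ?_⟩⟩
  · exact tendsto_measureReal_le_iInf_coverage hA hZ hbounded hstable hδ hε
  · exact tendsto_measureReal_iSup_coverage_le hA hZ hbounded hstable hδ hε
  · exact ((hZ n hn).integrable_coverageError hA (by omega)).congr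
      ((hZ n hn).iSup_condCoverage_ae_eq A).symm
  · refine (tendsto_integral_coverageError hA hZ hbounded hstable hcc).congr' ?_
    filter_upwards [eventually_ge_atTop 2] with n hn
    exact (integral_congr_ae ((hZ n hn).iSup_condCoverage_ae_eq A)).symm
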